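/- Let $1\le m\le d$, $T\ge 1$ be integers and let $\mathcal S\subseteq\{0,1\}^d$ be a nonempty set with $\|v\|_1\le m$ for all $v\in\mathcal S$. In each round $t=1,\dots,T$ a learner chooses $V_t\in\mathcal S$ and a non-oblivious environment chooses a loss vector $\ell_t\in[0,1]^d$, which may depend arbitrarily on everything that happened before round $t$ but not on the learner's random draws of round $t$. The regret is $R_T=\max_{v\in\mathcal S}\sum_{t=1}^T (V_t-v)^{\mathsf T}\ell_t$. The algorithm FPL+GR.P with parameters $\eta>0$, $\beta>0$ and an integer $M\ge1$ works as follows. In round $t$ it draws independent vectors $Z_t,Z_t'(1),\dots,Z_t'(M)\in\mathbb R^d$, independent of the past and with independent standard exponential components, and sets \[V_t\in\arg\min_{v\in\mathcal S}v^{\mathsf T}\big(\eta\widetilde L_{t-1}-Z_t\big),\qquad V_t'(k)\in\arg\min_{v\in\mathcal S}v^{\mathsf T}\big(\eta\widetilde L_{t-1}-Z_t'(k)\big)\quad(k=1,\dots,M),\] where $\widetilde L_{t}=\sum_{s=1}^{t}\widetilde\ell_s$ and, for $i=1,\dots,d$, \[K_{t,i}=\min\big(\{k: V'_{t,i}(k)=1\}\cup\{M\}\big),\qquad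 \widehat\ell_{t,i}=K_{t,i}V_{t,i}\ell_{t,i},\qquad \widetilde\ell_{t,i}=\tfrac1\beta\log\big(1+\beta\widehat\ell_{t,i}\big).\] Fix $\delta>0$. With probability at least $1-\delta$, the regret of FPL+GR.P satisfies \[\begin{aligned}R_T\le{}&\frac{m(\log(d/m)+1)}{\eta}+\eta\Big(Mm\sqrt{2T\log\tfrac5\delta}+2md\sqrt{T\log\tfrac5\delta}+2mdT\Big)+\frac{dT}{eM}\\&+\beta\Big(M\sqrt{2mT\log\tfrac5\delta}+2d\sqrt{T\log\tfrac5\delta}+2dT\Big)+\frac{m\log(5d/\delta)}{\beta}\\&+m\sqrt{2(e-2)T}\,\log\tfrac5\delta+\sqrt{8T\log\tfrac5\delta}+\sqrt{2(e-2)T}.\end{aligned}\] In particular, with $M=\big\lceil\sqrt{dT/m}\,\big\rceil$, $\beta=\sqrt{m/(dT)}$ and $\eta=\sqrt{(\log(d/m)+1)/(dT)}$, with probability at least $1-\delta$, \[\begin{aligned}R_T\le{}&3m\sqrt{dT\big(\log\tfrac dm+1\big)}+\sqrt{mdT}\Big(\log\tfrac{5d}\delta+2\Big)+\sqrt{2mT\log\tfrac5\delta}\Big(\sqrt{\log\tfrac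 dm+1}+1\Big)\\&+1.2\,m\sqrt T\log\tfrac5\delta+\sqrt T\Big(\sqrt{8\log\tfrac5\delta}+1.2\Big)+2\sqrt{d\log\tfrac5\delta}\Big(m\sqrt{\log\tfrac dm+1}+\sqrt m\Big).\end{aligned}\] -/

import Mathlib

open MeasureTheory ProbabilityTheory
open scoped Matrix

namespace FPLGRP

noncomputable section

/-- `o` is a linear optimization oracle over `S`: it maps each cost vector `c` to a minimizer of
`vᵀ c` over `v ∈ S`, ties being broken by an arbitrary measurable rule. -/
structure IsLinearOracle {d : ℕ} (S : Finset (Fin d → ℝ)) (o : (Fin d → ℝ) → (Fin d → ℝ)) :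
    Prop where
  mem : ∀ c, o c ∈ S
  le : ∀ c, ∀ u ∈ S, o c ⬝ᵥ c ≤ u ⬝ᵥ c
  measurable : Measurable o

/-- The `k`-th action sampled in a round: the minimizer of `vᵀ (η L - Z k)` over the action set,
where `L` is the current cumulative loss estimate. The index `0` belongs to the action that is
actually played, the indices `1, …, M` to the resampled copies used by Geometric Resampling. -/
def sampledAction {d M : ℕ} (o : (Fin d → ℝ) → (Fin d → ℝ)) (η : ℝ) (L : Fin d → ℝ)
    (Z : Fin (M + 1) → Fin d → ℝ) (k : Fin (M + 1)) : Fin d → ℝ :=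
  o (η • L - Z k)

/-- The Geometric Resampling counter `K_i = min ({k ∈ {1, …, M} : V'(k)_i = 1} ∪ {M})`, where
`V 1, …, V M` are the resampled copies (the entry `V 0` is the played action and is not used). -/
def resamplingCount {d M : ℕ} (V : Fin (M + 1) → Fin d → ℝ) (i : Fin d) : ℕ :=
  sInf ({k : ℕ | ∃ j : Fin M, (j : ℕ) + 1 = k ∧ V j.succ i = 1} ∪ {M})

/-- The Geometric Resampling estimate `K_i V_i ℓ_i` of the `i`-th loss. -/
def grEstimate {d M : ℕ} (V : Fin (M + 1) → Fin d → ℝ) (l : Fin d → ℝ) (i : Fin d) : ℝ :=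
  (resamplingCount V i : ℝ) * V 0 i * l i

/-- The loss estimate `(1/β) log (1 + β K_i V_i ℓ_i)`. -/
def logEstimate {d M : ℕ} (β : ℝ) (V : Fin (M + 1) → Fin d → ℝ) (l : Fin d → ℝ) (i : Fin d) : ℝ :=
  1 / β * Real.log (1 + β * grEstimate V l i)

/-- The cumulative loss estimate of FPL+GR.P before round `t`, when the loss vectors are
`l 0, l 1, …` and the perturbations drawn in round `s` are `Z s 0, …, Z s M`. Rounds are
numbered from `0`. -/
def cumEstimate {d M : ℕ} (o : (Fin d → ℝ) → (Fin d → ℝ)) (η β : ℝ)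
    (l : ℕ → Fin d → ℝ) (Z : ℕ → Fin (M + 1) → Fin d → ℝ) : ℕ → Fin d → ℝ
  | 0 => 0
  | t + 1 => cumEstimate o η β l Z t +
      logEstimate β (sampledAction o η (cumEstimate o η β l Z t) (Z t)) (l t)

/-- The action played by FPL+GR.P in round `t`. -/
def playedAction {d M : ℕ} (o : (Fin d → ℝ) → (Fin d → ℝ)) (η β : ℝ)
    (l : ℕ → Fin d → ℝ) (Z : ℕ → Fin (M + 1) → Fin d → ℝ) (t : ℕ) : Fin d → ℝ :=
  sampledAction o η (cumEstimate o η β l Z t) (Z t) 0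

/-- The regret `max_{v ∈ S} ∑_{t < T} (V_t - v)ᵀ ℓ_t` of the action sequence `V` against the loss
sequence `l`. -/
def regret {d : ℕ} (S : Finset (Fin d → ℝ)) (hS : S.Nonempty) (T : ℕ)
    (V l : ℕ → Fin d → ℝ) : ℝ :=
  S.sup' hS fun v => ∑ t ∈ Finset.range T, (V t - v) ⬝ᵥ l t

end

end FPLGRP

namespace FPLGRP

noncomputable section

/-! The potential is `Φ(c) = E min_v v·(c - Z)`, formalized as `leaderValue`. The exponential law is
memoryless, so adding a cost `ηl ≥ 0` shrinks the probability of choosing `v` by at most the factor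
`exp(-η v·l)` (`exp_mul_actionProb_le`). Hence each round raises `Φ` by at least `η` times the
discounted loss of the estimate. Telescoping, together with `Φ(0) ≥ -m(log(d/m)+1)` and `Φ(c) ≤
u·c`, bounds the sum of discounted losses by `u·L_T + m(log(d/m)+1)/η` on every path
(`sum_discountedLoss_le`).

Two comparisons with the true losses remain, and each needs only one tail. The comparator side
requires `u·L_T` not to exceed the true loss of `u` by much. The logarithm in the estimate is chosen
so that `exp(β · estimate) = 1 + β K V ℓ`, whose mean is at most `exp(βℓ)`; thus `E exp(β(estimate -
ℓ)) ≤ 1` (`lintegral_exp_logEstimate_le`). The learner side requires the suffered loss not to exceed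
the discounted estimate by much (`lintegral_exp_excess_le`). The estimate can be of order `M`, but
it enters with a negative sign, so a quadratic bound on the exponential survives without
boundedness, and only second moments appear. They are controlled because `q E[V K²] ≤ 2` when the
coordinate is played with probability `q`.

Both exponential bounds are conditional on the past, so the products over rounds have expectation at
most 1, and Markov's inequality gives the tails (`measureReal_sum_ge_le`). A union bound over one
learner event and `d` coordinate events concludes. The result has no `M√T` or `d√T` deviation terms;
these are slack in the stated bounds. -/

instance isProbabilityMeasure_expMeasure_one : IsProbabilityMeasure (expMeasure 1) :=
  isProbabilityMeasure_expMeasure one_pos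

/-- The law of a perturbation vector with i.i.d. standard exponential components. -/
abbrev perturbationLaw (d : ℕ) : Measure (Fin d → ℝ) := Measure.pi fun _ => expMeasure 1

/-- The law of the `M + 1` perturbation vectors drawn in one round. -/
abbrev roundLaw (M d : ℕ) : Measure (Fin (M + 1) → Fin d → ℝ) :=
  Measure.pi fun _ => perturbationLaw d

/-! ### Exponential perturbations: shifts, absence of atoms, moments. -/

lemma expMeasure_one_eq : expMeasure 1 = volume.withDensity (exponentialPDF 1) := rfl

lemma measurable_exponentialPDF (r : ℝ) : Measurable (exponentialPDF r) :=
  (measurable_exponentialPDFReal r).ennreal_ofReal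

lemma exponentialPDF_one_le {s : ℝ} (hs : 0 ≤ s) (x : ℝ) :
    exponentialPDF 1 x ≤ ENNReal.ofReal (Real.exp s) * exponentialPDF 1 (x + s) := by
  rcases lt_or_ge x 0 with hx | hx
  · simp [exponentialPDF_of_neg hx]
  · rw [exponentialPDF_of_nonneg hx, exponentialPDF_of_nonneg (add_nonneg hx hs),
      ← ENNReal.ofReal_mul (Real.exp_pos s).le]
    refine ENNReal.ofReal_le_ofReal (le_of_eq ?_)
    rw [one_mul, one_mul, one_mul, one_mul, ← Real.exp_add]
    congr 1; ring

lemma exponentialPDF_one_add {a : ℝ} (ha : 0 ≤ a) {x : ℝ} (hx : 0 ≤ x) :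
    exponentialPDF 1 (x + a) = ENNReal.ofReal (Real.exp (-a)) * exponentialPDF 1 x := by
  rw [exponentialPDF_of_nonneg hx, exponentialPDF_of_nonneg (add_nonneg hx ha),
    ← ENNReal.ofReal_mul (Real.exp_pos _).le]
  congr 1
  rw [one_mul, one_mul, one_mul, one_mul, ← Real.exp_add]
  congr 1; ring

lemma expMeasure_one_le_shift {s : ℝ} (hs : 0 ≤ s) :
    expMeasure 1 ≤ Real.toNNReal (Real.exp s) • (expMeasure 1).map fun x => x - s := by
  refine Measure.le_iff.2 fun B hB => ?_
  have hm : Measurable fun x : ℝ => x - s := measurable_id.sub_const s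
  rw [Measure.smul_apply, Measure.map_apply hm hB, expMeasure_one_eq, withDensity_apply _ hB,
    withDensity_apply _ (hm hB), ← lintegral_indicator (hm hB), ← lintegral_indicator hB,
    ← lintegral_add_right_eq_self (Set.indicator ((fun x => x - s) ⁻¹' B) _) s,
    ENNReal.smul_def, smul_eq_mul, ← lintegral_const_mul']
  · refine lintegral_mono fun x => ?_
    by_cases hx : x ∈ B
    · simp only [Set.indicator, Set.mem_preimage, add_sub_cancel_right, hx, if_true]
      exact exponentialPDF_one_le hs x
    · simp [Set.indicator, hx]
  · exact ENNReal.coe_ne_top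

/-- The product outer measure is the largest one dominated by the product of the factors on boxes,
so comparing on boxes suffices. -/
lemma pi_mono_measure {ι : Type*} [Fintype ι] {α : ι → Type*} [∀ i, MeasurableSpace (α i)]
    {μ ν : ∀ i, Measure (α i)} [∀ i, SigmaFinite (μ i)] (h : ∀ i, μ i ≤ ν i) :
    Measure.pi μ ≤ Measure.pi ν := by
  refine Measure.le_iff.2 fun A hA => ?_
  rw [Measure.pi_def ν, toMeasure_apply _ _ hA]
  suffices (Measure.pi μ).toOuterMeasure ≤ OuterMeasure.pi fun i => (ν i).toOuterMeasure from
    this A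
  refine OuterMeasure.le_pi.2 fun s _ => ?_
  exact (Measure.pi_pi μ s).trans_le (Finset.prod_le_prod' fun i _ => h i _)

lemma pi_smul_measure {ι : Type*} [Fintype ι] {α : ι → Type*} [∀ i, MeasurableSpace (α i)]
    (c : ι → NNReal) (ν : ∀ i, Measure (α i)) [∀ i, IsFiniteMeasure (ν i)] :
    (Measure.pi fun i => c i • ν i) = (∏ i, c i) • Measure.pi ν := by
  refine Measure.pi_eq fun s _ => ?_
  rw [Measure.smul_apply, Measure.pi_pi, ENNReal.smul_def, smul_eq_mul, ENNReal.ofNNReal_finsetProd,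
    ← Finset.prod_mul_distrib]
  rfl

/-- Shifting the perturbation by a nonnegative vector `s` changes probabilities by a factor of at
most `exp (∑ i, s i)`. -/
lemma perturbationLaw_real_le_shift {d : ℕ} {s : Fin d → ℝ} (hs : ∀ i, 0 ≤ s i)
    {A : Set (Fin d → ℝ)} (hA : MeasurableSet A) :
    (perturbationLaw d).real A ≤
      Real.exp (∑ i, s i) * (perturbationLaw d).real ((fun z => z - s) ⁻¹' A) := by
  have : ∀ i, IsProbabilityMeasure ((expMeasure 1).map fun x => x - s i) := fun i =>
    Measure.isProbabilityMeasure_map (by fun_prop)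
  have hm : Measurable fun z : Fin d → ℝ => z - s := measurable_id.sub_const s
  have hmap : (perturbationLaw d).map (fun z => z - s) =
      Measure.pi fun i => (expMeasure 1).map fun x => x - s i :=
    Measure.pi_map_pi (μ := fun _ : Fin d => expMeasure 1)
      (f := fun i x => x - s i) (fun i => by fun_prop)
  have h := (pi_mono_measure fun i => expMeasure_one_le_shift (hs i)).trans_eq
    (pi_smul_measure (fun i => Real.toNNReal (Real.exp (s i))) _) A
  rw [← hmap, Measure.smul_apply, Measure.map_apply hm hA, ENNReal.smul_def, smul_eq_mul] at h
  have h' := ENNReal.toReal_mono (by finiteness) h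
  rw [ENNReal.toReal_mul] at h'
  refine h'.trans_eq ?_
  congr 1
  simp [Real.exp_sum, Real.exp_nonneg]

/-- A nontrivial linear form of the perturbation has no atoms. -/
lemma perturbationLaw_dotProduct_eq_null {d : ℕ} {w : Fin d → ℝ} (hw : w ≠ 0) (c : Fin d → ℝ) :
    perturbationLaw d {z | w ⬝ᵥ (c - z) = 0} = 0 := by
  obtain ⟨i, hi⟩ := Function.ne_iff.1 hw
  have hmeas : ∀ a : ℝ, MeasurableSet {z : Fin d → ℝ | w ⬝ᵥ (c - z) = a} := fun a =>
    measurableSet_eq_fun (by unfold dotProduct; fun_prop) measurable_const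
  -- The translates of the hyperplane along a direction with `w i ≠ 0` are pairwise disjoint. All
  -- shifts have length at most 1, so each translate keeps at least a fraction `1/e` of the mass;
  -- infinitely many fit into total mass 1 only if that mass is zero.
  set s : ℕ → Fin d → ℝ := fun n => Pi.single i (1 / ((n : ℝ) + 1)) with hs
  set E : ℕ → Set (Fin d → ℝ) := fun n => (fun z => z - s n) ⁻¹' {z | w ⬝ᵥ (c - z) = 0} with hE
  have hEm : ∀ n, MeasurableSet (E n) := fun n =>
    (measurable_id.sub_const (s n)) (hmeas 0)
  have hEeq : ∀ n z, z ∈ E n → w ⬝ᵥ (c - z) = - (w i * (1 / ((n : ℝ) + 1))) := by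
    intro n z hz
    have hz' : w ⬝ᵥ (c - (z - s n)) = 0 := hz
    have : c - (z - s n) = (c - z) + s n := by abel
    rw [this, dotProduct_add, hs, dotProduct_single] at hz'
    linarith
  have hdisj : Pairwise (Function.onFun Disjoint E) := by
    intro n k hnk
    refine Set.disjoint_left.2 fun z hn hk => hnk ?_
    have h := (hEeq n z hn).symm.trans (hEeq k z hk)
    have h2 : (1 / ((n : ℝ) + 1)) = 1 / ((k : ℝ) + 1) := mul_left_cancel₀ hi (neg_injective h)
    have h3 : ((n : ℝ) + 1) = (k : ℝ) + 1 := by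
      simpa using congrArg (fun x => x⁻¹) h2
    exact_mod_cast add_right_cancel h3
  by_contra hne
  have hpos : 0 < (perturbationLaw d).real {z | w ⬝ᵥ (c - z) = 0} :=
    ENNReal.toReal_pos hne (by finiteness)
  have hlow : ∀ n, (perturbationLaw d).real {z | w ⬝ᵥ (c - z) = 0} / Real.exp 1 ≤
      (perturbationLaw d).real (E n) := by
    intro n
    have hn : 1 / ((n : ℝ) + 1) ≤ 1 := by
      rw [div_le_one (by positivity)]; linarith [n.cast_nonneg (α := ℝ)]
    have h := perturbationLaw_real_le_shift (s := s n) (fun j => by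
      have h0 : (0 : Fin d → ℝ) ≤ s n := Pi.single_nonneg.2 (by positivity)
      exact h0 j) (hmeas 0)
    rw [div_le_iff₀ (Real.exp_pos 1), mul_comm]
    refine h.trans (mul_le_mul_of_nonneg_right (Real.exp_le_exp.2 ?_) measureReal_nonneg)
    simpa [hs] using hn
  obtain ⟨N, hN⟩ := exists_nat_gt
    (((perturbationLaw d).real {z | w ⬝ᵥ (c - z) = 0} / Real.exp 1)⁻¹)
  have hsum : ∑ n ∈ Finset.range N, (perturbationLaw d).real (E n) ≤ 1 := by
    rw [← measureReal_biUnion_finset (fun a _ b _ hab => hdisj hab) fun n _ => hEm n]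
    exact measureReal_le_one
  have h1 := (Finset.card_nsmul_le_sum (Finset.range N) _ _ fun n _ => hlow n).trans hsum
  have hq : 0 < (perturbationLaw d).real {z | w ⬝ᵥ (c - z) = 0} / Real.exp 1 := by positivity
  rw [Finset.card_range, nsmul_eq_mul] at h1
  rw [inv_lt_iff_one_lt_mul₀' hq] at hN
  linarith [mul_comm (N : ℝ) ((perturbationLaw d).real {z | w ⬝ᵥ (c - z) = 0} / Real.exp 1)]

lemma expMeasure_one_ae_nonneg : ∀ᵐ x ∂expMeasure 1, 0 ≤ x := by
  rw [expMeasure_one_eq, ae_withDensity_iff (measurable_exponentialPDF 1)]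
  refine Filter.Eventually.of_forall fun x hx => ?_
  by_contra h
  exact hx (exponentialPDF_of_neg (not_le.1 h))

/-- `ENNReal.ofReal` truncates at zero, so this is the mean of the positive part. Translating by `a`
pulls out `exp(-a)` by memorylessness and leaves the mean 1. -/
lemma lintegral_expMeasure_one_sub {a : ℝ} (ha : 0 ≤ a) :
    ∫⁻ x, ENNReal.ofReal (x - a) ∂expMeasure 1 = ENNReal.ofReal (Real.exp (-a)) := by
  have h2 : ∫⁻ x, exponentialPDF 1 x * ENNReal.ofReal x = 1 := by
    -- `x exp(-x)` is the density of the Gamma law with shape 2 and rate 1.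
    rw [← lintegral_gammaPDF_eq_one (a := 2) (r := 1) two_pos one_pos]
    refine lintegral_congr fun x => ?_
    rcases lt_or_ge x 0 with hx | hx
    · rw [exponentialPDF_of_neg hx, gammaPDF_of_neg hx, zero_mul]
    · rw [exponentialPDF_of_nonneg hx, gammaPDF_of_nonneg hx, ← ENNReal.ofReal_mul (by positivity)]
      congr 1
      norm_num [Real.Gamma_two]
      ring
  rw [expMeasure_one_eq, lintegral_withDensity_eq_lintegral_mul _ (measurable_exponentialPDF 1)
    (by fun_prop), ← lintegral_add_right_eq_self _ a]
  calc ∫⁻ x, (exponentialPDF 1 * fun x => ENNReal.ofReal (x - a)) (x + a)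
      = ∫⁻ x, ENNReal.ofReal (Real.exp (-a)) * (exponentialPDF 1 x * ENNReal.ofReal x) := by
        refine lintegral_congr fun x => ?_
        rcases lt_or_ge x 0 with hx | hx
        · simp [ENNReal.ofReal_of_nonpos hx.le]
        · simp [exponentialPDF_one_add ha hx, mul_assoc]
    _ = ENNReal.ofReal (Real.exp (-a)) := by
        rw [lintegral_const_mul' _ _ ENNReal.ofReal_ne_top, h2, mul_one]

lemma integrable_id_expMeasure_one : Integrable (fun x : ℝ => x) (expMeasure 1) := by
  refine ⟨by fun_prop, ?_⟩
  rw [hasFiniteIntegral_iff_enorm]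
  have h : ∫⁻ x, ‖x‖ₑ ∂expMeasure 1 = ∫⁻ x, ENNReal.ofReal (x - 0) ∂expMeasure 1 := by
    refine lintegral_congr_ae ?_
    filter_upwards [expMeasure_one_ae_nonneg] with x hx
    rw [sub_zero, Real.enorm_of_nonneg hx]
  rw [h, lintegral_expMeasure_one_sub le_rfl]
  finiteness

lemma integral_expMeasure_one_posPart_sub {a : ℝ} (ha : 0 ≤ a) :
    ∫ x, max (x - a) 0 ∂expMeasure 1 = Real.exp (-a) := by
  rw [integral_eq_lintegral_of_nonneg_ae
    (Filter.Eventually.of_forall fun x => le_max_right (x - a) 0) (by fun_prop)]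
  simp only [ENNReal.ofReal_max, ENNReal.ofReal_zero, zero_le, sup_of_le_left]
  rw [lintegral_expMeasure_one_sub ha, ENNReal.toReal_ofReal (Real.exp_pos _).le]

lemma perturbationLaw_ae_nonneg (d : ℕ) : ∀ᵐ z ∂perturbationLaw d, ∀ i, 0 ≤ z i := by
  refine ae_all_iff.2 fun i => ?_
  exact (measurePreserving_eval (fun _ : Fin d => expMeasure 1) i).quasiMeasurePreserving.ae
    expMeasure_one_ae_nonneg

lemma integrable_eval_perturbationLaw {d : ℕ} (i : Fin d) :
    Integrable (fun z => z i) (perturbationLaw d) :=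
  (measurePreserving_eval (fun _ : Fin d => expMeasure 1) i).integrable_comp_of_integrable
    integrable_id_expMeasure_one

lemma integral_perturbationLaw_posPart_sub {d : ℕ} (i : Fin d) {a : ℝ} (ha : 0 ≤ a) :
    ∫ z, max (z i - a) 0 ∂perturbationLaw d = Real.exp (-a) := by
  rw [← integral_expMeasure_one_posPart_sub ha,
    ← (measurePreserving_eval (fun _ : Fin d => expMeasure 1) i).map_eq,
    integral_map (measurable_pi_apply i).aemeasurable (by fun_prop)]

/-! ### The potential of the perturbed leader. -/

/-- The probability that the oracle `o` returns `v` on the perturbed cost vector `c - z`. -/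
def actionProb {d : ℕ} (o : (Fin d → ℝ) → (Fin d → ℝ)) (c v : Fin d → ℝ) : ℝ :=
  (perturbationLaw d).real {z | o (c - z) = v}

/-- The expectation of the `i`-th coordinate of the perturbed leader `o (c - z)`. -/
def meanAction {d : ℕ} (o : (Fin d → ℝ) → (Fin d → ℝ)) (c : Fin d → ℝ) (i : Fin d) : ℝ :=
  ∫ z, o (c - z) i ∂perturbationLaw d

/-- The expected optimal value of the linear problem with perturbed costs `c - z`. -/
def leaderValue {d : ℕ} (o : (Fin d → ℝ) → (Fin d → ℝ)) (c : Fin d → ℝ) : ℝ :=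
  ∫ z, o (c - z) ⬝ᵥ (c - z) ∂perturbationLaw d

/-- The expected loss `v ⬝ᵥ l` of the perturbed leader `v`, discounted by `exp (-η v ⬝ᵥ l)`. -/
def discountedLoss {d : ℕ} (S : Finset (Fin d → ℝ)) (o : (Fin d → ℝ) → (Fin d → ℝ)) (η : ℝ)
    (c l : Fin d → ℝ) : ℝ :=
  ∑ v ∈ S, actionProb o c v * (v ⬝ᵥ l * Real.exp (-(η * v ⬝ᵥ l)))

section

variable {d m : ℕ} {S : Finset (Fin d → ℝ)} {o : (Fin d → ℝ) → (Fin d → ℝ)}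

lemma actionProb_nonneg (c v : Fin d → ℝ) : 0 ≤ actionProb o c v := measureReal_nonneg

lemma measurableSet_oracle_eq (ho : IsLinearOracle S o) (c v : Fin d → ℝ) :
    MeasurableSet {z | o (c - z) = v} :=
  (ho.measurable.comp (measurable_const.sub measurable_id)) (measurableSet_singleton v)

lemma integral_comp_oracle (ho : IsLinearOracle S o) (c : Fin d → ℝ) (f : (Fin d → ℝ) → ℝ) :
    ∫ z, f (o (c - z)) ∂perturbationLaw d = ∑ v ∈ S, actionProb o c v * f v := by
  have h : ∀ z, f (o (c - z)) = ∑ v ∈ S, Set.indicator {z | o (c - z) = v} (fun _ => f v) z := by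
    intro z
    rw [Finset.sum_eq_single (o (c - z))]
    · simp
    · intro v _ hv
      simp [Ne.symm hv]
    · exact fun hz => absurd (ho.mem _) hz
  simp_rw [h]
  rw [integral_finsetSum _ fun v _ =>
    (integrable_const (f v)).indicator (measurableSet_oracle_eq ho c v)]
  refine Finset.sum_congr rfl fun v _ => ?_
  rw [integral_indicator_const _ (measurableSet_oracle_eq ho c v)]
  rfl

lemma meanAction_eq_sum (ho : IsLinearOracle S o) (c : Fin d → ℝ) (i : Fin d) :
    meanAction o c i = ∑ v ∈ S, actionProb o c v * v i :=
  integral_comp_oracle ho c fun v => v i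

lemma sum_actionProb_mul_dotProduct (ho : IsLinearOracle S o) (c l : Fin d → ℝ) :
    ∑ v ∈ S, actionProb o c v * v ⬝ᵥ l = ∑ i, meanAction o c i * l i := by
  simp_rw [meanAction_eq_sum ho, Finset.sum_mul, dotProduct, Finset.mul_sum]
  rw [Finset.sum_comm]
  simp_rw [mul_assoc]

lemma integrable_oracle_dotProduct (ho : IsLinearOracle S o)
    (hS01 : ∀ v ∈ S, ∀ i, v i = 0 ∨ v i = 1) (c b : Fin d → ℝ) :
    Integrable (fun z => o (b - z) ⬝ᵥ (c - z)) (perturbationLaw d) := by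
  unfold dotProduct
  refine integrable_finsetSum _ fun i _ => ?_
  refine Integrable.bdd_mul (c := 1)
    ((integrable_const (c i)).sub (integrable_eval_perturbationLaw i)) ?_ ?_
  · exact ((measurable_pi_apply i).comp
      (ho.measurable.comp (measurable_const.sub measurable_id))).aestronglyMeasurable
  · refine Filter.Eventually.of_forall fun z => ?_
    rcases hS01 _ (ho.mem (b - z)) i with h | h <;> simp [h]

/-- Almost surely the perturbed linear problem has a unique solution. -/
lemma ae_oracle_eq_of_isMin (ho : IsLinearOracle S o) (c : Fin d → ℝ) :
    ∀ᵐ z ∂perturbationLaw d, ∀ v ∈ S, (∀ u ∈ S, v ⬝ᵥ (c - z) ≤ u ⬝ᵥ (c - z)) →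
      o (c - z) = v := by
  have h : ∀ᵐ z ∂perturbationLaw d, ∀ u ∈ S, ∀ v ∈ S, u ≠ v → (u - v) ⬝ᵥ (c - z) ≠ 0 := by
    refine (ae_ball_iff S.countable_toSet).2 fun u _ => ?_
    refine (ae_ball_iff S.countable_toSet).2 fun v _ => ?_
    by_cases huv : u = v
    · simp [huv]
    · have := perturbationLaw_dotProduct_eq_null (sub_ne_zero.2 huv) c
      refine (measure_eq_zero_iff_ae_notMem.1 this).mono fun z hz _ => hz
  filter_upwards [h] with z hz v hv hmin
  by_contra hne
  refine hz _ (ho.mem (c - z)) v hv hne ?_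
  rw [sub_dotProduct, sub_eq_zero]
  exact le_antisymm (ho.le _ v hv) (hmin _ (ho.mem _))

/-- Adding the loss vector `l` decreases the probability of `v` by a factor of at most
`exp (-η v ⬝ᵥ l)`. -/
lemma exp_mul_actionProb_le (ho : IsLinearOracle S o) (hS01 : ∀ v ∈ S, ∀ i, v i = 0 ∨ v i = 1)
    {η : ℝ} (hη : 0 ≤ η) {c l v : Fin d → ℝ} (hl : ∀ i, 0 ≤ l i) (hv : v ∈ S) :
    actionProb o c v * Real.exp (-(η * v ⬝ᵥ l)) ≤ actionProb o (c + η • l) v := by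
  have hnn : ∀ u ∈ S, ∀ i, 0 ≤ u i := fun u hu i => by
    rcases hS01 u hu i with h | h <;> simp [h]
  have hle1 : ∀ u ∈ S, ∀ i, u i ≤ 1 := fun u hu i => by
    rcases hS01 u hu i with h | h <;> simp [h]
  -- The shift charges `ηl` only on the support of `v`. Passing from `c + s` to `c + ηl` then adds
  -- no cost to `v` and a nonnegative cost to every competitor, so `v` stays optimal; almost sure
  -- uniqueness makes the oracle return it.
  set s : Fin d → ℝ := fun i => η * (v i * l i) with hs
  have hs0 : ∀ i, 0 ≤ s i := fun i => mul_nonneg hη (mul_nonneg (hnn v hv i) (hl i))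
  have hsum : ∑ i, s i = η * v ⬝ᵥ l := by simp [hs, dotProduct, Finset.mul_sum]
  have h1 := perturbationLaw_real_le_shift hs0 (measurableSet_oracle_eq ho c v)
  have h2 : (perturbationLaw d).real ((fun z => z - s) ⁻¹' {z | o (c - z) = v}) ≤
      actionProb o (c + η • l) v := by
    refine ENNReal.toReal_mono (by finiteness) (measure_mono_ae ?_)
    filter_upwards [ae_oracle_eq_of_isMin ho (c + η • l)] with z hz hzv
    have hzv' : o (c - (z - s)) = v := hzv
    refine hz v hv fun u hu => ?_
    have hmin := ho.le (c - (z - s)) u hu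
    rw [hzv'] at hmin
    have e : c + η • l - z = (c - (z - s)) + (η • l - s) := by abel
    rw [e, dotProduct_add, dotProduct_add]
    refine add_le_add hmin (Finset.sum_le_sum fun i _ => ?_)
    have e2 : (η • l - s) i = η * l i * (1 - v i) := by simp [hs]; ring
    rw [e2]
    have hηl := mul_nonneg hη (hl i)
    rcases hS01 v hv i with h | h
    · rw [h]; simpa using mul_nonneg (hnn u hu i) hηl
    · simp [h]
  rw [hsum] at h1
  have h3 : actionProb o c v ≤ Real.exp (η * v ⬝ᵥ l) * actionProb o (c + η • l) v :=
    h1.trans (mul_le_mul_of_nonneg_left h2 (Real.exp_pos _).le)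
  rw [Real.exp_neg, ← div_eq_mul_inv, div_le_iff₀ (Real.exp_pos _)]
  linarith

/-- The new leader pays at least the old optimum on the old costs, plus its own loss on `ηl`; that
loss is compared with the old action probabilities through `exp_mul_actionProb_le`. -/
lemma leaderValue_add_le (ho : IsLinearOracle S o) (hS01 : ∀ v ∈ S, ∀ i, v i = 0 ∨ v i = 1)
    {η : ℝ} (hη : 0 ≤ η) (c : Fin d → ℝ) {l : Fin d → ℝ} (hl : ∀ i, 0 ≤ l i) :
    leaderValue o c + η * discountedLoss S o η c l ≤ leaderValue o (c + η • l) := by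
  have hnn : ∀ u ∈ S, 0 ≤ u ⬝ᵥ l := fun u hu => Finset.sum_nonneg fun i _ =>
    mul_nonneg (by rcases hS01 u hu i with h | h <;> simp [h]) (hl i)
  have hint := integrable_oracle_dotProduct ho hS01 c (c + η • l)
  have hint2 : Integrable (fun z => η * o (c + η • l - z) ⬝ᵥ l) (perturbationLaw d) := by
    have := (integrable_oracle_dotProduct ho hS01 (c + η • l) (c + η • l)).sub hint
    refine this.congr (Filter.Eventually.of_forall fun z => ?_)
    simp only [Pi.sub_apply]
    rw [← dotProduct_sub]
    have : c + η • l - z - (c - z) = η • l := by abel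
    rw [this, dotProduct_smul, smul_eq_mul]
  have e : leaderValue o (c + η • l) =
      ∫ z, o (c + η • l - z) ⬝ᵥ (c - z) ∂perturbationLaw d +
        η * ∑ v ∈ S, actionProb o (c + η • l) v * v ⬝ᵥ l := by
    rw [← integral_comp_oracle ho (c + η • l) fun v => v ⬝ᵥ l, ← integral_const_mul,
      ← integral_add hint hint2]
    refine integral_congr_ae (Filter.Eventually.of_forall fun z => ?_)
    have : c + η • l - z = (c - z) + η • l := by abel
    simp only
    nth_rewrite 2 [this]
    rw [dotProduct_add, dotProduct_smul, smul_eq_mul]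
  rw [e]
  refine add_le_add ?_ (mul_le_mul_of_nonneg_left ?_ hη)
  · exact integral_mono (integrable_oracle_dotProduct ho hS01 c c) hint fun z =>
      ho.le (c - z) _ (ho.mem _)
  · refine Finset.sum_le_sum fun v hv => ?_
    have := mul_le_mul_of_nonneg_right (exp_mul_actionProb_le ho hS01 hη (c := c) hl hv) (hnn v hv)
    linarith

lemma leaderValue_le (ho : IsLinearOracle S o) (hS01 : ∀ v ∈ S, ∀ i, v i = 0 ∨ v i = 1)
    (c : Fin d → ℝ) {u : Fin d → ℝ} (hu : u ∈ S) : leaderValue o c ≤ u ⬝ᵥ c := by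
  have h : leaderValue o c ≤ ∫ _, u ⬝ᵥ c ∂perturbationLaw d := by
    refine integral_mono_ae (integrable_oracle_dotProduct ho hS01 c c) (integrable_const _) ?_
    filter_upwards [perturbationLaw_ae_nonneg d] with z hz
    refine (ho.le (c - z) u hu).trans (Finset.sum_le_sum fun i _ => ?_)
    have : 0 ≤ u i := by rcases hS01 u hu i with h | h <;> simp [h]
    exact mul_le_mul_of_nonneg_left (by simpa using hz i) this
  simpa using h

/-- The expected maximum of `v·Z` is bounded by thresholding: each of at most `m` active coordinates
costs `a`, plus the overshoot `(Z_i - a)⁺` summed over all `d` coordinates, of mean `d exp(-a)`. The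
choice `a = log(d/m)` makes the overshoot equal to `m`. -/
lemma neg_le_leaderValue_zero (ho : IsLinearOracle S o)
    (hS01 : ∀ v ∈ S, ∀ i, v i = 0 ∨ v i = 1) (hSm : ∀ v ∈ S, ∑ i, |v i| ≤ m) (hm : 1 ≤ m)
    (hmd : m ≤ d) : -(m * (Real.log (d / m) + 1)) ≤ leaderValue o 0 := by
  have hm0 : (0 : ℝ) < m := by exact_mod_cast hm
  have hmd' : (m : ℝ) ≤ d := by exact_mod_cast hmd
  have hd0 : (0 : ℝ) < d := hm0.trans_le hmd'
  set a := Real.log (d / m) with ha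
  have ha0 : 0 ≤ a := Real.log_nonneg ((one_le_div hm0).2 hmd')
  have hi : ∀ i : Fin d, Integrable (fun z : Fin d → ℝ => max (z i - a) 0) (perturbationLaw d) :=
    fun i => ((integrable_eval_perturbationLaw i).sub (integrable_const a)).sup
      (integrable_const 0)
  have hint : Integrable (fun z : Fin d → ℝ => -(m * a + ∑ i, max (z i - a) 0))
      (perturbationLaw d) :=
    ((integrable_const _).add (integrable_finsetSum _ fun i _ => hi i)).neg
  have hval : ∫ z, -(m * a + ∑ i, max (z i - a) 0) ∂perturbationLaw d = -(m * (a + 1)) := by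
    rw [integral_neg, integral_add (integrable_const _) (integrable_finsetSum _ fun i _ => hi i),
      integral_finsetSum _ fun i _ => hi i]
    simp_rw [integral_perturbationLaw_posPart_sub _ ha0]
    have he : Real.exp (-a) = m / d := by
      rw [Real.exp_neg, ha, Real.exp_log (by positivity), inv_div]
    simp [he]
    field_simp
    ring
  rw [← hval]
  refine integral_mono hint (integrable_oracle_dotProduct ho hS01 0 0) fun z => ?_
  have hv := ho.mem (0 - z)
  set v := o (0 - z)
  have h1 : v ⬝ᵥ z ≤ m * a + ∑ i, max (z i - a) 0 := by
    calc v ⬝ᵥ z ≤ ∑ i, (|v i| * a + max (z i - a) 0) := by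
          refine Finset.sum_le_sum fun i _ => ?_
          rcases hS01 v hv i with h | h
          · simp [h]
          · simp only [h, one_mul, abs_one]
            linarith [le_max_left (z i - a) 0]
      _ = (∑ i, |v i|) * a + ∑ i, max (z i - a) 0 := by
          rw [Finset.sum_add_distrib, Finset.sum_mul]
      _ ≤ _ := by gcongr; exact hSm v hv
  simp only [zero_sub, dotProduct_neg]
  linarith

/-- The be-the-leader bound: the discounted losses of the perturbed leader compete with every
fixed action, on arbitrary nonnegative loss sequences. -/
lemma sum_discountedLoss_le (ho : IsLinearOracle S o)
    (hS01 : ∀ v ∈ S, ∀ i, v i = 0 ∨ v i = 1) (hSm : ∀ v ∈ S, ∑ i, |v i| ≤ m) (hm : 1 ≤ m)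
    (hmd : m ≤ d) {η : ℝ} (hη : 0 < η) {L l : ℕ → Fin d → ℝ} (hL0 : L 0 = 0)
    (hL : ∀ t, L (t + 1) = L t + l t) {T : ℕ} (hl : ∀ t < T, ∀ i, 0 ≤ l t i)
    {u : Fin d → ℝ} (hu : u ∈ S) :
    ∑ t ∈ Finset.range T, discountedLoss S o η (η • L t) (l t) ≤
      u ⬝ᵥ L T + m * (Real.log (d / m) + 1) / η := by
  have h : ∀ n ≤ T, leaderValue o 0 +
      η * ∑ t ∈ Finset.range n, discountedLoss S o η (η • L t) (l t) ≤
        leaderValue o (η • L n) := by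
    intro n
    induction n with
    | zero => simp [hL0]
    | succ n ih =>
      intro hn
      have h1 := leaderValue_add_le ho hS01 hη.le (η • L n) (hl n hn)
      rw [Finset.sum_range_succ, hL, smul_add]
      linarith [ih (by omega)]
  have h1 := h T le_rfl
  have h2 := leaderValue_le ho hS01 (η • L T) hu
  have h3 := neg_le_leaderValue_zero ho hS01 hSm hm hmd
  rw [dotProduct_smul, smul_eq_mul] at h2
  rw [← sub_le_iff_le_add', le_div_iff₀ hη]
  linarith

end

/-! ### Moments of the geometric resampling counter. -/

/-- The indicator that the first `k` resampled actions all miss the coordinate `i`. -/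
def missIndicator {d M : ℕ} (V : Fin (M + 1) → Fin d → ℝ) (i : Fin d) (k : ℕ) : ℝ :=
  ∏ j : Fin M, if (j : ℕ) < k then 1 - V j.succ i else 1

section

variable {d m M : ℕ} {S : Finset (Fin d → ℝ)} {o : (Fin d → ℝ) → (Fin d → ℝ)}

/-- Copy number `j + 1` is `V j.succ`, so the indices `j < k` are exactly the first `k` copies; `k <
M` keeps the cap `M` from interfering. -/
lemma lt_resamplingCount_iff (V : Fin (M + 1) → Fin d → ℝ) (i : Fin d) {k : ℕ} (hk : k < M) :
    k < resamplingCount V i ↔ ∀ j : Fin M, (j : ℕ) < k → V j.succ i ≠ 1 := by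
  unfold resamplingCount
  rw [← Nat.succ_le_iff, le_csInf_iff (OrderBot.bddBelow _) ⟨M, Or.inr rfl⟩]
  constructor
  · intro h j hj h1
    have := h (j + 1) (Or.inl ⟨j, rfl, h1⟩)
    omega
  · rintro h b (⟨j, rfl, hj⟩ | hb)
    · by_contra hlt
      exact h j (by omega) hj
    · rw [Set.mem_singleton_iff.1 hb]; omega

lemma resamplingCount_le (V : Fin (M + 1) → Fin d → ℝ) (i : Fin d) : resamplingCount V i ≤ M :=
  Nat.sInf_le (Or.inr rfl)

lemma missIndicator_eq {V : Fin (M + 1) → Fin d → ℝ} {i : Fin d} (hV : ∀ k, V k i = 0 ∨ V k i = 1)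
    {k : ℕ} (hk : k < M) :
    missIndicator V i k = if k < resamplingCount V i then 1 else 0 := by
  unfold missIndicator
  split_ifs with h
  · rw [lt_resamplingCount_iff V i hk] at h
    refine Finset.prod_eq_one fun j _ => ?_
    split_ifs with hj
    · rw [(hV j.succ).resolve_right (h j hj), sub_zero]
    · rfl
  · rw [lt_resamplingCount_iff V i hk] at h
    push Not at h
    obtain ⟨j, hj, h1⟩ := h
    exact Finset.prod_eq_zero (Finset.mem_univ j) (by simp [hj, h1])

lemma sum_range_ite_lt {n N : ℕ} (hn : n ≤ N) (f : ℕ → ℝ) :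
    ∑ k ∈ Finset.range N, f k * (if k < n then 1 else 0) = ∑ k ∈ Finset.range n, f k := by
  simp only [mul_ite, mul_one, mul_zero]
  rw [← Finset.sum_filter]
  refine Finset.sum_congr ?_ fun _ _ => rfl
  ext k
  simp only [Finset.mem_filter, Finset.mem_range]
  omega

/-- A tail-sum formula: each summand is a product over independent copies, so its expectation
factorizes. -/
lemma resamplingCount_eq_sum {V : Fin (M + 1) → Fin d → ℝ} {i : Fin d}
    (hV : ∀ k, V k i = 0 ∨ V k i = 1) :
    (resamplingCount V i : ℝ) = ∑ k ∈ Finset.range M, missIndicator V i k := by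
  have h := sum_range_ite_lt (resamplingCount_le V i) fun _ => 1
  rw [Finset.sum_const, Finset.card_range, nsmul_one] at h
  rw [← h]
  refine Finset.sum_congr rfl fun k hk => ?_
  rw [missIndicator_eq hV (Finset.mem_range.1 hk), one_mul]

lemma resamplingCount_sq_eq_sum {V : Fin (M + 1) → Fin d → ℝ} {i : Fin d}
    (hV : ∀ k, V k i = 0 ∨ V k i = 1) :
    (resamplingCount V i : ℝ) ^ 2 =
      ∑ k ∈ Finset.range M, (2 * (k : ℝ) + 1) * missIndicator V i k := by
  have hsq : ∀ n : ℕ, ∑ k ∈ Finset.range n, (2 * (k : ℝ) + 1) = (n : ℝ) ^ 2 := by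
    intro n
    induction n with
    | zero => simp
    | succ n ih => rw [Finset.sum_range_succ, ih]; push_cast; ring
  have h := sum_range_ite_lt (resamplingCount_le V i) fun k => 2 * (k : ℝ) + 1
  rw [← hsq, ← h]
  refine Finset.sum_congr rfl fun k hk => ?_
  rw [missIndicator_eq hV (Finset.mem_range.1 hk)]

lemma prod_fin_ite_lt (a : ℝ) {k N : ℕ} (hk : k ≤ N) :
    ∏ j : Fin N, (if (j : ℕ) < k then a else 1) = a ^ k := by
  rw [Fin.prod_univ_eq_prod_range (fun j => if j < k then a else 1) N, Finset.prod_ite,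
    Finset.prod_const_one, mul_one, Finset.prod_const]
  congr 1
  rw [show Finset.filter (fun j => j < k) (Finset.range N) = Finset.range k by
    ext j; simp only [Finset.mem_filter, Finset.mem_range]; omega, Finset.card_range]

lemma sq_mul_sum_le_two {q : ℝ} (h0 : 0 ≤ q) (h1 : q ≤ 1) (n : ℕ) :
    q ^ 2 * ∑ k ∈ Finset.range n, (2 * (k : ℝ) + 1) * (1 - q) ^ k ≤ 2 := by
  -- Closed form of the truncated series; the subtracted remainder is nonnegative.
  have h : q ^ 2 * ∑ k ∈ Finset.range n, (2 * (k : ℝ) + 1) * (1 - q) ^ k =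
      2 - q - (1 - q) ^ n * (2 * n * q + 2 - q) := by
    induction n with
    | zero => simp
    | succ n ih => rw [Finset.sum_range_succ, mul_add, ih]; push_cast; ring
  rw [h]
  have : 0 ≤ (1 - q) ^ n * (2 * n * q + 2 - q) :=
    mul_nonneg (pow_nonneg (by linarith) n) (by nlinarith [mul_nonneg n.cast_nonneg (α := ℝ) h0])
  linarith

/-- From `(1 - q)^n ≤ exp(-qn)` and `x exp(-x) ≤ 1/e`. This is the truncation bias, the source of
`dT/(eM)`. -/
lemma mul_one_sub_pow_le {q : ℝ} (h0 : 0 ≤ q) (h1 : q ≤ 1) {n : ℕ} (hn : 0 < n) :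
    q * (1 - q) ^ n ≤ 1 / (Real.exp 1 * n) := by
  have hn' : (0 : ℝ) < n := by exact_mod_cast hn
  have h2 : (1 - q) ^ n ≤ Real.exp (-(q * n)) := by
    calc (1 - q) ^ n ≤ Real.exp (-q) ^ n :=
          pow_le_pow_left₀ (by linarith) (Real.one_sub_le_exp_neg q) n
      _ = Real.exp (-(q * n)) := by rw [← Real.exp_nat_mul]; congr 1; ring
  have h3 : q * n ≤ Real.exp (q * n - 1) := by linarith [Real.add_one_le_exp (q * n - 1)]
  have h4 : q * n * Real.exp (-(q * n)) ≤ (Real.exp 1)⁻¹ := by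
    calc q * n * Real.exp (-(q * n)) ≤ Real.exp (q * n - 1) * Real.exp (-(q * n)) := by gcongr
      _ = (Real.exp 1)⁻¹ := by rw [← Real.exp_add, ← Real.exp_neg]; congr 1; ring
  rw [one_div, mul_inv, ← div_eq_mul_inv, le_div_iff₀ hn']
  calc q * (1 - q) ^ n * n ≤ q * Real.exp (-(q * n)) * n := by gcongr
    _ = q * n * Real.exp (-(q * n)) := by ring
    _ ≤ _ := h4

lemma oracle_mem_Icc (ho : IsLinearOracle S o) (hS01 : ∀ v ∈ S, ∀ i, v i = 0 ∨ v i = 1)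
    (c : Fin d → ℝ) (i : Fin d) : o c i ∈ Set.Icc (0 : ℝ) 1 := by
  rcases hS01 _ (ho.mem c) i with h | h <;> simp [h]

lemma measurable_oracle_eval (ho : IsLinearOracle S o) (c : Fin d → ℝ) (i : Fin d) :
    Measurable fun z => o (c - z) i :=
  (measurable_pi_apply i).comp (ho.measurable.comp (measurable_const.sub measurable_id))

lemma integrable_oracle_eval (ho : IsLinearOracle S o)
    (hS01 : ∀ v ∈ S, ∀ i, v i = 0 ∨ v i = 1) (c : Fin d → ℝ) (i : Fin d) :
    Integrable (fun z => o (c - z) i) (perturbationLaw d) :=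
  Integrable.of_mem_Icc 0 1 (measurable_oracle_eval ho c i).aemeasurable
    (Filter.Eventually.of_forall fun z => oracle_mem_Icc ho hS01 (c - z) i)

lemma meanAction_nonneg (ho : IsLinearOracle S o) (hS01 : ∀ v ∈ S, ∀ i, v i = 0 ∨ v i = 1)
    (c : Fin d → ℝ) (i : Fin d) : 0 ≤ meanAction o c i :=
  integral_nonneg fun z => (oracle_mem_Icc ho hS01 (c - z) i).1

lemma meanAction_le_one (ho : IsLinearOracle S o) (hS01 : ∀ v ∈ S, ∀ i, v i = 0 ∨ v i = 1)
    (c : Fin d → ℝ) (i : Fin d) : meanAction o c i ≤ 1 := by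
  have := integral_mono (integrable_oracle_eval ho hS01 c i) (integrable_const (1 : ℝ))
    fun z => (oracle_mem_Icc ho hS01 (c - z) i).2
  simpa [meanAction] using this

lemma sum_meanAction_le (ho : IsLinearOracle S o) (hS01 : ∀ v ∈ S, ∀ i, v i = 0 ∨ v i = 1)
    (hSm : ∀ v ∈ S, ∑ i, |v i| ≤ m) (c : Fin d → ℝ) : ∑ i, meanAction o c i ≤ m := by
  unfold meanAction
  rw [← integral_finsetSum _ fun i _ => integrable_oracle_eval ho hS01 c i]
  have := integral_mono (integrable_finsetSum Finset.univ fun i _ =>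
    integrable_oracle_eval ho hS01 c i) (integrable_const (m : ℝ)) fun z =>
      (Finset.sum_le_sum fun i _ => le_abs_self (o (c - z) i)).trans (hSm _ (ho.mem (c - z)))
  simpa using this

/-- The played coordinate times the miss indicator is a product of functions of independent
perturbations. -/
lemma mul_missIndicator_eq_prod (c : Fin d → ℝ) (i : Fin d) (k : ℕ)
    (z : Fin (M + 1) → Fin d → ℝ) :
    o (c - z 0) i * missIndicator (fun n => o (c - z n)) i k =
      ∏ n : Fin (M + 1), (Fin.cons (fun x => o (c - x) i)
        (fun (j : Fin M) x => if (j : ℕ) < k then 1 - o (c - x) i else 1) :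
          Fin (M + 1) → (Fin d → ℝ) → ℝ) n (z n) := by
  rw [Fin.prod_univ_succ]
  simp only [Fin.cons_zero, Fin.cons_succ]
  rfl

lemma integrable_mul_missIndicator (ho : IsLinearOracle S o)
    (hS01 : ∀ v ∈ S, ∀ i, v i = 0 ∨ v i = 1) (c : Fin d → ℝ) (i : Fin d) (k : ℕ) :
    Integrable (fun z : Fin (M + 1) → Fin d → ℝ =>
      o (c - z 0) i * missIndicator (fun n => o (c - z n)) i k) (roundLaw M d) := by
  simp_rw [mul_missIndicator_eq_prod]
  refine Integrable.fintype_prod fun n => ?_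
  refine Fin.cases ?_ (fun j => ?_) n
  · exact integrable_oracle_eval ho hS01 c i
  · simp only [Fin.cons_succ]
    split_ifs
    · exact (integrable_const 1).sub (integrable_oracle_eval ho hS01 c i)
    · exact integrable_const 1

lemma integral_mul_missIndicator (ho : IsLinearOracle S o)
    (hS01 : ∀ v ∈ S, ∀ i, v i = 0 ∨ v i = 1) (c : Fin d → ℝ) (i : Fin d) {k : ℕ} (hk : k < M) :
    ∫ z, o (c - z 0) i * missIndicator (fun n => o (c - z n)) i k ∂roundLaw M d =
      meanAction o c i * (1 - meanAction o c i) ^ k := by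
  simp_rw [mul_missIndicator_eq_prod]
  rw [integral_fintype_prod_eq_prod, Fin.prod_univ_succ, ← prod_fin_ite_lt _ hk.le]
  congr 1
  refine Finset.prod_congr rfl fun j _ => ?_
  simp only [Fin.cons_succ]
  split_ifs
  · rw [integral_sub (integrable_const 1) (integrable_oracle_eval ho hS01 c i)]
    simp [meanAction]
  · simp

lemma integrable_mul_resamplingCount (ho : IsLinearOracle S o)
    (hS01 : ∀ v ∈ S, ∀ i, v i = 0 ∨ v i = 1) (c : Fin d → ℝ) (i : Fin d) :
    Integrable (fun z : Fin (M + 1) → Fin d → ℝ =>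
      o (c - z 0) i * (resamplingCount (fun n => o (c - z n)) i : ℝ)) (roundLaw M d) := by
  simp_rw [resamplingCount_eq_sum fun k => hS01 _ (ho.mem _) i, Finset.mul_sum]
  exact integrable_finsetSum _ fun k _ => integrable_mul_missIndicator ho hS01 c i k

lemma integral_mul_resamplingCount (ho : IsLinearOracle S o)
    (hS01 : ∀ v ∈ S, ∀ i, v i = 0 ∨ v i = 1) (c : Fin d → ℝ) (i : Fin d) :
    ∫ z, o (c - z 0) i * (resamplingCount (fun n => o (c - z n)) i : ℝ) ∂roundLaw M d =
      1 - (1 - meanAction o c i) ^ M := by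
  simp_rw [resamplingCount_eq_sum fun k => hS01 _ (ho.mem _) i, Finset.mul_sum]
  rw [integral_finsetSum _ fun k _ => integrable_mul_missIndicator ho hS01 c i k,
    Finset.sum_congr rfl fun k hk =>
      integral_mul_missIndicator ho hS01 c i (Finset.mem_range.1 hk), ← Finset.mul_sum]
  have := mul_neg_geom_sum (1 - meanAction o c i) M
  rwa [sub_sub_cancel] at this

lemma integrable_mul_resamplingCount_sq (ho : IsLinearOracle S o)
    (hS01 : ∀ v ∈ S, ∀ i, v i = 0 ∨ v i = 1) (c : Fin d → ℝ) (i : Fin d) :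
    Integrable (fun z : Fin (M + 1) → Fin d → ℝ =>
      o (c - z 0) i * (resamplingCount (fun n => o (c - z n)) i : ℝ) ^ 2) (roundLaw M d) := by
  simp_rw [resamplingCount_sq_eq_sum fun k => hS01 _ (ho.mem _) i, Finset.mul_sum,
    mul_left_comm (o _ i)]
  exact integrable_finsetSum _ fun k _ =>
    (integrable_mul_missIndicator ho hS01 c i k).const_mul _

/-- The played action contributes a second factor `q`, independent of the copies, so
`sq_mul_sum_le_two` applies with `q²`. -/
lemma meanAction_mul_integral_resamplingCount_sq_le (ho : IsLinearOracle S o)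
    (hS01 : ∀ v ∈ S, ∀ i, v i = 0 ∨ v i = 1) (c : Fin d → ℝ) (i : Fin d) :
    meanAction o c i * ∫ z, o (c - z 0) i *
      (resamplingCount (fun n => o (c - z n)) i : ℝ) ^ 2 ∂roundLaw M d ≤ 2 := by
  simp_rw [resamplingCount_sq_eq_sum fun k => hS01 _ (ho.mem _) i, Finset.mul_sum,
    mul_left_comm (o _ i)]
  rw [integral_finsetSum _ fun k _ =>
    (integrable_mul_missIndicator ho hS01 c i k).const_mul _]
  simp_rw [integral_const_mul]
  rw [Finset.sum_congr rfl fun k hk => by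
    rw [integral_mul_missIndicator ho hS01 c i (Finset.mem_range.1 hk)]]
  refine le_trans (le_of_eq ?_) (sq_mul_sum_le_two (meanAction_nonneg ho hS01 c i)
    (meanAction_le_one ho hS01 c i) M)
  simp_rw [Finset.mul_sum]
  exact Finset.sum_congr rfl fun k _ => by ring

end

/-! ### Exponential moments within one round. -/

/-- Only `a` need be bounded by 1: when `g` is large the exponent is negative, where the exponential
lies below its quadratic Taylor polynomial. This is what keeps `M` out of the deviation terms. -/
lemma exp_sub_le_of_le_one {a g h : ℝ} (ha0 : 0 ≤ a) (ha1 : a ≤ 1) (hg : 0 ≤ g) (hgh : g ≤ h) :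
    Real.exp (a - g) ≤ 1 + (a - g) + 3 / 4 * a ^ 2 + 1 / 2 * h ^ 2 := by
  rcases le_total 0 (a - g) with hx | hx
  · have h1 := Real.exp_bound' hx (by linarith) two_pos
    rw [show Finset.range 2 = {0, 1} by decide, Finset.sum_pair (by norm_num)] at h1
    norm_num at h1
    nlinarith [sq_nonneg h]
  · have h1 := Real.quadratic_le_exp_of_nonneg (neg_nonneg.2 hx)
    have h2 : Real.exp (a - g) * Real.exp (-(a - g)) = 1 := by rw [← Real.exp_add]; simp
    -- With `x = a - g`, this inverts `exp(-x) ≥ 1 - x + x²/2`, since `(1 - x + x²/2)(1 + x + x²/2)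
    -- = 1 + x⁴/4`.
    have h3 : Real.exp (a - g) ≤ 1 + (a - g) + (a - g) ^ 2 / 2 := by
      have hp := Real.exp_pos (a - g)
      have h4 : Real.exp (a - g) * (1 - (a - g) + (a - g) ^ 2 / 2) ≤ 1 := by
        rw [← h2]; exact mul_le_mul_of_nonneg_left (by linarith) hp.le
      have h5 : 0 < 1 - (a - g) + (a - g) ^ 2 / 2 := by nlinarith [sq_nonneg (a - g)]
      refine le_of_mul_le_mul_right (h4.trans ?_) h5
      nlinarith [sq_nonneg ((a - g) ^ 2)]
    nlinarith [sq_nonneg a]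

section

variable {d m M : ℕ} {S : Finset (Fin d → ℝ)} {o : (Fin d → ℝ) → (Fin d → ℝ)}

lemma grEstimate_nonneg {V : Fin (M + 1) → Fin d → ℝ} {l : Fin d → ℝ} {i : Fin d}
    (hV : 0 ≤ V 0 i) (hl : 0 ≤ l i) : 0 ≤ grEstimate V l i :=
  mul_nonneg (mul_nonneg (Nat.cast_nonneg _) hV) hl

lemma logEstimate_nonneg {β : ℝ} (hβ : 0 < β) {V : Fin (M + 1) → Fin d → ℝ} {l : Fin d → ℝ}
    {i : Fin d} (h : 0 ≤ grEstimate V l i) : 0 ≤ logEstimate β V l i :=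
  mul_nonneg (by positivity) (Real.log_nonneg (by nlinarith))

lemma logEstimate_le {β : ℝ} (hβ : 0 < β) {V : Fin (M + 1) → Fin d → ℝ} {l : Fin d → ℝ}
    {i : Fin d} (h : 0 ≤ grEstimate V l i) : logEstimate β V l i ≤ grEstimate V l i := by
  have h0 : 0 ≤ β * grEstimate V l i := by positivity
  have h1 := Real.log_le_sub_one_of_pos (show 0 < 1 + β * grEstimate V l i by linarith)
  unfold logEstimate
  rw [one_div, inv_mul_le_iff₀ hβ]
  linarith

lemma le_logEstimate {β : ℝ} (hβ : 0 < β) {V : Fin (M + 1) → Fin d → ℝ} {l : Fin d → ℝ}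
    {i : Fin d} (h : 0 ≤ grEstimate V l i) :
    grEstimate V l i - β / 2 * grEstimate V l i ^ 2 ≤ logEstimate β V l i := by
  unfold logEstimate
  set x := grEstimate V l i
  have h0 : 0 ≤ β * x := by positivity
  -- Through `log(1 + y) ≥ 2y/(y + 2)`, which dominates `y - y²/2` for `y ≥ 0`.
  have h1 : β * x - (β * x) ^ 2 / 2 ≤ Real.log (1 + β * x) := by
    refine le_trans ?_ (Real.le_log_one_add_of_nonneg h0)
    rw [le_div_iff₀ (by linarith)]
    nlinarith [pow_nonneg h0 3]
  rw [one_div, ← div_eq_inv_mul, le_div_iff₀ hβ]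
  linarith

/-- The log-biased estimates have a controlled exponential moment. -/
lemma lintegral_exp_logEstimate_le (ho : IsLinearOracle S o)
    (hS01 : ∀ v ∈ S, ∀ i, v i = 0 ∨ v i = 1) {β : ℝ} (hβ : 0 < β) (c : Fin d → ℝ)
    {l : Fin d → ℝ} (hl : ∀ i, l i ∈ Set.Icc (0 : ℝ) 1) (i : Fin d) :
    ∫⁻ z, ENNReal.ofReal (Real.exp
      (β * (logEstimate β (fun n => o (c - z n)) l i - l i))) ∂roundLaw M d ≤ 1 := by
  have hnn : ∀ z : Fin (M + 1) → Fin d → ℝ, 0 ≤ grEstimate (fun n => o (c - z n)) l i := fun z =>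
    grEstimate_nonneg (oracle_mem_Icc ho hS01 (c - z 0) i).1 (hl i).1
  have e : ∀ z : Fin (M + 1) → Fin d → ℝ,
      Real.exp (β * (logEstimate β (fun n => o (c - z n)) l i - l i)) =
        Real.exp (-(β * l i)) * (1 + β * l i *
          (o (c - z 0) i * (resamplingCount (fun n => o (c - z n)) i : ℝ))) := by
    intro z
    have h0 : 0 < 1 + β * grEstimate (fun n => o (c - z n)) l i := by nlinarith [hnn z]
    rw [mul_sub, sub_eq_neg_add, Real.exp_add, logEstimate, ← mul_assoc, mul_one_div_cancel hβ.ne',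
      one_mul, Real.exp_log h0, grEstimate]
    ring
  have hint : Integrable (fun z : Fin (M + 1) → Fin d → ℝ => 1 + β * l i *
      (o (c - z 0) i * (resamplingCount (fun n => o (c - z n)) i : ℝ))) (roundLaw M d) :=
    (integrable_const 1).add ((integrable_mul_resamplingCount ho hS01 c i).const_mul _)
  rw [← ofReal_integral_eq_lintegral_ofReal (by simp_rw [e]; exact hint.const_mul _)
    (Filter.Eventually.of_forall fun z => (Real.exp_pos _).le), ENNReal.ofReal_le_one]
  simp_rw [e]
  rw [integral_const_mul, integral_add (integrable_const 1)
    ((integrable_mul_resamplingCount ho hS01 c i).const_mul _), integral_const_mul,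
    integral_mul_resamplingCount ho hS01]
  have hq := pow_nonneg (sub_nonneg.2 (meanAction_le_one ho hS01 c i)) M
  have hβl : 0 ≤ β * l i := mul_nonneg hβ.le (hl i).1
  have h1 : 1 + β * l i * (1 - (1 - meanAction o c i) ^ M) ≤ Real.exp (β * l i) := by
    have := Real.add_one_le_exp (β * l i)
    nlinarith [mul_nonneg hβl hq]
  rw [Real.exp_neg, inv_mul_le_iff₀ (Real.exp_pos _), mul_one]
  simpa using h1

lemma discountedLoss_nonneg (hS01 : ∀ v ∈ S, ∀ i, v i = 0 ∨ v i = 1) {η : ℝ} (c : Fin d → ℝ)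
    {l : Fin d → ℝ} (hl : ∀ i, 0 ≤ l i) : 0 ≤ discountedLoss S o η c l := by
  refine Finset.sum_nonneg fun v hv => mul_nonneg (actionProb_nonneg c v)
    (mul_nonneg (Finset.sum_nonneg fun i _ => mul_nonneg ?_ (hl i)) (Real.exp_pos _).le)
  rcases hS01 v hv i with h | h <;> simp [h]

lemma discountedLoss_le (ho : IsLinearOracle S o) (hS01 : ∀ v ∈ S, ∀ i, v i = 0 ∨ v i = 1)
    {η : ℝ} (hη : 0 ≤ η) (c : Fin d → ℝ) {l : Fin d → ℝ} (hl : ∀ i, 0 ≤ l i) :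
    discountedLoss S o η c l ≤ ∑ i, meanAction o c i * l i := by
  rw [← sum_actionProb_mul_dotProduct ho]
  refine Finset.sum_le_sum fun v hv => mul_le_mul_of_nonneg_left ?_ (actionProb_nonneg c v)
  have h0 : 0 ≤ v ⬝ᵥ l := Finset.sum_nonneg fun i _ => mul_nonneg
    (by rcases hS01 v hv i with h | h <;> simp [h]) (hl i)
  exact mul_le_of_le_one_right h0 (Real.exp_le_one_iff.2 (neg_nonpos.2 (mul_nonneg hη h0)))

/-- Cauchy–Schwarz restricted to the support of `v`, which has at most `m` elements; hence `m`
instead of `d`. -/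
lemma sq_dotProduct_le (hS01 : ∀ v ∈ S, ∀ i, v i = 0 ∨ v i = 1)
    (hSm : ∀ v ∈ S, ∑ i, |v i| ≤ m) {v : Fin d → ℝ} (hv : v ∈ S) (x : Fin d → ℝ) :
    (v ⬝ᵥ x) ^ 2 ≤ m * ∑ i, v i * x i ^ 2 := by
  have h1 := Finset.sum_mul_sq_le_sq_mul_sq Finset.univ v fun i => v i * x i
  have hvv : ∀ i, v i ^ 2 = v i := fun i => by rcases hS01 v hv i with h | h <;> simp [h]
  have e1 : ∑ i, v i * (v i * x i) = v ⬝ᵥ x :=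
    Finset.sum_congr rfl fun i _ => by rw [← mul_assoc, ← sq, hvv]
  have e2 : ∑ i, (v i * x i) ^ 2 = ∑ i, v i * x i ^ 2 :=
    Finset.sum_congr rfl fun i _ => by rw [mul_pow, hvv]
  rw [e1, e2] at h1
  have h0 : 0 ≤ ∑ i, v i * x i ^ 2 := Finset.sum_nonneg fun i _ => mul_nonneg
    (by rw [← hvv]; positivity) (sq_nonneg _)
  refine h1.trans (mul_le_mul_of_nonneg_right ((Finset.sum_le_sum fun i _ => ?_).trans
    (hSm v hv)) h0)
  rw [hvv]; exact le_abs_self _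

/-- The price of discounting: `exp(-x) ≥ 1 - x`, and the resulting square is handled by
`sq_dotProduct_le`. -/
lemma le_discountedLoss (ho : IsLinearOracle S o) (hS01 : ∀ v ∈ S, ∀ i, v i = 0 ∨ v i = 1)
    (hSm : ∀ v ∈ S, ∑ i, |v i| ≤ m) {η : ℝ} (hη : 0 ≤ η) (c : Fin d → ℝ) {l : Fin d → ℝ}
    (hl : ∀ i, 0 ≤ l i) :
    ∑ i, meanAction o c i * l i - η * m * ∑ i, meanAction o c i * l i ^ 2 ≤
      discountedLoss S o η c l := by
  have h1 := sum_actionProb_mul_dotProduct ho c l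
  have h2 := sum_actionProb_mul_dotProduct ho c fun i => l i ^ 2
  rw [← h1, ← h2, Finset.mul_sum, ← Finset.sum_sub_distrib]
  refine Finset.sum_le_sum fun v hv => ?_
  have hp := actionProb_nonneg (o := o) c v
  have h0 : 0 ≤ v ⬝ᵥ l := Finset.sum_nonneg fun i _ => mul_nonneg
    (by rcases hS01 v hv i with h | h <;> simp [h]) (hl i)
  have h3 : (v ⬝ᵥ l) ^ 2 ≤ m * v ⬝ᵥ (fun i => l i ^ 2) := sq_dotProduct_le hS01 hSm hv l
  have h4 := Real.add_one_le_exp (-(η * v ⬝ᵥ l))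
  have h5 : v ⬝ᵥ l - η * m * v ⬝ᵥ (fun i => l i ^ 2) ≤
      v ⬝ᵥ l * Real.exp (-(η * v ⬝ᵥ l)) := by
    nlinarith [mul_le_mul_of_nonneg_left h4 h0, mul_le_mul_of_nonneg_left h3 hη]
  nlinarith [mul_le_mul_of_nonneg_left h5 hp]

/-- The exponential moment of the difference of the loss suffered in a round and its discounted
estimate, given the cost vector `c` of the leader and the loss `l`. -/
lemma lintegral_exp_excess_le (ho : IsLinearOracle S o)
    (hS01 : ∀ v ∈ S, ∀ i, v i = 0 ∨ v i = 1) (hSm : ∀ v ∈ S, ∑ i, |v i| ≤ m) (hM : 0 < M)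
    {η β r : ℝ} (hη : 0 < η) (hβ : 0 < β) (hr : 0 < r) (hrm : r * m ≤ 1) (c : Fin d → ℝ)
    {l : Fin d → ℝ} (hl : ∀ i, l i ∈ Set.Icc (0 : ℝ) 1) :
    ∫⁻ z, ENNReal.ofReal (Real.exp (r * (o (c - z 0) ⬝ᵥ l -
        discountedLoss S o η c (logEstimate β (fun n => o (c - z n)) l)) -
      (r * (d / (Real.exp 1 * M) + β * d + 2 * η * m * d) + 7 / 4 * r ^ 2 * m ^ 2)))
        ∂roundLaw M d ≤ 1 := by
  -- The three linear terms are the truncation bias, the logarithmic bias and the discount. In `7/4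
  -- = 3/4 + 1`, the `3/4` comes from the suffered loss and the `1` from the second moment of the
  -- estimate.
  set κ := r * (d / (Real.exp 1 * M) + β * d + 2 * η * m * d) + 7 / 4 * r ^ 2 * m ^ 2 with hκ
  set q := meanAction o c with hq
  have hq0 := meanAction_nonneg ho hS01 c
  have hq1 := meanAction_le_one ho hS01 c
  rw [← hq] at hq0 hq1
  set A : Fin d → (Fin (M + 1) → Fin d → ℝ) → ℝ := fun i z =>
    o (c - z 0) i * (resamplingCount (fun n => o (c - z n)) i : ℝ) with hA
  set B : Fin d → (Fin (M + 1) → Fin d → ℝ) → ℝ := fun i z =>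
    o (c - z 0) i * (resamplingCount (fun n => o (c - z n)) i : ℝ) ^ 2 with hB
  have hAi : ∀ i, Integrable (A i) (roundLaw M d) := integrable_mul_resamplingCount ho hS01 c
  have hBi : ∀ i, Integrable (B i) (roundLaw M d) := integrable_mul_resamplingCount_sq ho hS01 c
  have hVi : ∀ i, Integrable (fun z : Fin (M + 1) → Fin d → ℝ => o (c - z 0) i)
      (roundLaw M d) := fun i =>
    (measurePreserving_eval (fun _ : Fin (M + 1) => perturbationLaw d)
      0).integrable_comp_of_integrable (integrable_oracle_eval ho hS01 c i)
  have hVint : ∀ i, ∫ z : Fin (M + 1) → Fin d → ℝ, o (c - z 0) i ∂roundLaw M d = q i := by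
    intro i
    rw [hq, meanAction, ← (measurePreserving_eval (fun _ : Fin (M + 1) => perturbationLaw d)
      0).map_eq, integral_map (measurable_pi_apply _).aemeasurable
      (measurable_oracle_eval ho c i).aestronglyMeasurable]
  -- A majorant linear in `V`, `VK` and `VK²`, whose expectations are all available.
  set D : (Fin (M + 1) → Fin d → ℝ) → ℝ := fun z =>
    ∑ i, (r * l i * o (c - z 0) i - r * (q i * l i) * A i z +
      (r * (β / 2 + η * m) * q i + 1 / 2 * r ^ 2 * m * q i ^ 2) * B i z) with hD
  have hUi : ∀ i, Integrable (fun z : Fin (M + 1) → Fin d → ℝ =>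
      r * l i * o (c - z 0) i - r * (q i * l i) * A i z) (roundLaw M d) := fun i =>
    ((hVi i).const_mul _).sub ((hAi i).const_mul _)
  have hTi : ∀ i, Integrable (fun z : Fin (M + 1) → Fin d → ℝ =>
      r * l i * o (c - z 0) i - r * (q i * l i) * A i z +
      (r * (β / 2 + η * m) * q i + 1 / 2 * r ^ 2 * m * q i ^ 2) * B i z) (roundLaw M d) := fun i =>
    (hUi i).add ((hBi i).const_mul _)
  have hDint : Integrable D (roundLaw M d) := integrable_finsetSum _ fun i _ => hTi i
  have hDi : Integrable (fun z => 1 + 3 / 4 * (r * m) ^ 2 + D z) (roundLaw M d) :=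
    (integrable_const _).add hDint
  have hpt : ∀ z, Real.exp (r * (o (c - z 0) ⬝ᵥ l -
      discountedLoss S o η c (logEstimate β (fun n => o (c - z n)) l))) ≤
        1 + 3 / 4 * (r * m) ^ 2 + D z := by
    intro z
    set V : Fin (M + 1) → Fin d → ℝ := fun n => o (c - z n) with hV
    have hV0 : V 0 ∈ S := ho.mem _
    have hVm : ∀ i, V 0 i ∈ Set.Icc (0 : ℝ) 1 := oracle_mem_Icc ho hS01 (c - z 0)
    have hg : ∀ i, 0 ≤ grEstimate V l i := fun i => grEstimate_nonneg (hVm i).1 (hl i).1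
    have hlog : ∀ i, 0 ≤ logEstimate β V l i := fun i => logEstimate_nonneg hβ (hg i)
    have hgA : ∀ i, grEstimate V l i = l i * A i z := fun i => by
      simp only [grEstimate, hA, hV]; ring
    have hA0 : ∀ i, 0 ≤ A i z := fun i => mul_nonneg (hVm i).1 (Nat.cast_nonneg _)
    have hAB : ∀ i, A i z ^ 2 = B i z := fun i => by
      simp only [hA, hB]
      rw [mul_pow]
      congr 1
      rcases hS01 _ (ho.mem (c - z 0)) i with h | h <;> simp [h]
    have hgB : ∀ i, grEstimate V l i ^ 2 ≤ B i z := fun i => by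
      rw [hgA, mul_pow, hAB]
      exact mul_le_of_le_one_left (by rw [← hAB]; positivity)
        (pow_le_one₀ (hl i).1 (hl i).2)
    set G := discountedLoss S o η c (logEstimate β V l) with hG
    have hG0 : 0 ≤ G := discountedLoss_nonneg hS01 c hlog
    have hGle : G ≤ ∑ i, q i * grEstimate V l i :=
      (discountedLoss_le ho hS01 hη.le c hlog).trans (Finset.sum_le_sum fun i _ =>
        mul_le_mul_of_nonneg_left (logEstimate_le hβ (hg i)) (hq0 i))
    have hGge : ∑ i, (q i * (l i * A i z) - (β / 2 + η * m) * q i * B i z) ≤ G := by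
      refine le_trans ?_ (le_discountedLoss ho hS01 hSm hη.le c hlog)
      rw [Finset.mul_sum, ← Finset.sum_sub_distrib]
      refine Finset.sum_le_sum fun i _ => ?_
      have h1 := le_logEstimate hβ (hg i)
      have h2 := hgB i
      have h3 : logEstimate β V l i ^ 2 ≤ B i z :=
        (pow_le_pow_left₀ (hlog i) (logEstimate_le hβ (hg i)) 2).trans h2
      rw [← hq, ← hgA]
      have h4 : grEstimate V l i - β / 2 * B i z ≤ logEstimate β V l i := by nlinarith
      have hηm : 0 ≤ η * m * q i := mul_nonneg (by positivity) (hq0 i)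
      nlinarith [mul_le_mul_of_nonneg_left h4 (hq0 i), mul_le_mul_of_nonneg_left h3 hηm]
    -- Cauchy–Schwarz over the support of the played action. In expectation the right side is at
    -- most `m · 2 Σ q_i ≤ 2m²`.
    have hHsq : (∑ i, q i * grEstimate V l i) ^ 2 ≤ m * ∑ i, q i ^ 2 * B i z := by
      have h1 := sq_dotProduct_le hS01 hSm hV0 fun i =>
        q i * l i * (resamplingCount V i : ℝ)
      have e1 : V 0 ⬝ᵥ (fun i => q i * l i * (resamplingCount V i : ℝ)) =
          ∑ i, q i * grEstimate V l i := by
        refine Finset.sum_congr rfl fun i _ => ?_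
        simp only [grEstimate]; ring
      rw [e1] at h1
      refine h1.trans (mul_le_mul_of_nonneg_left (Finset.sum_le_sum fun i _ => ?_)
        (Nat.cast_nonneg _))
      have h2 : l i ^ 2 ≤ 1 := pow_le_one₀ (hl i).1 (hl i).2
      have h3 : 0 ≤ q i ^ 2 * B i z := mul_nonneg (sq_nonneg _) (by rw [← hAB]; positivity)
      calc V 0 i * (q i * l i * (resamplingCount V i : ℝ)) ^ 2 = l i ^ 2 * (q i ^ 2 * B i z) := by
            simp only [hB, hV]; ring
        _ ≤ _ := mul_le_of_le_one_left h3 h2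
    have ha0 : 0 ≤ V 0 ⬝ᵥ l :=
      Finset.sum_nonneg fun i _ => mul_nonneg (hVm i).1 (hl i).1
    have ham : V 0 ⬝ᵥ l ≤ m := by
      refine le_trans (Finset.sum_le_sum fun i _ => ?_) (hSm _ hV0)
      exact (mul_le_of_le_one_right (hVm i).1 (hl i).2).trans (le_abs_self _)
    have hra : r * V 0 ⬝ᵥ l ≤ r * m := mul_le_mul_of_nonneg_left ham hr.le
    have h1 := exp_sub_le_of_le_one (mul_nonneg hr.le ha0) (hra.trans hrm)
      (mul_nonneg hr.le hG0) (mul_le_mul_of_nonneg_left hGle hr.le)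
    rw [mul_sub]
    refine h1.trans ?_
    have h2 : (r * V 0 ⬝ᵥ l) ^ 2 ≤ (r * m) ^ 2 :=
      pow_le_pow_left₀ (mul_nonneg hr.le ha0) hra 2
    have h3 : (r * ∑ i, q i * grEstimate V l i) ^ 2 ≤ r ^ 2 * (m * ∑ i, q i ^ 2 * B i z) := by
      rw [mul_pow]; exact mul_le_mul_of_nonneg_left hHsq (sq_nonneg r)
    have h4 := mul_le_mul_of_nonneg_left hGge hr.le
    have e : D z = r * V 0 ⬝ᵥ l -
        r * (∑ i, (q i * (l i * A i z) - (β / 2 + η * m) * q i * B i z)) +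
          1 / 2 * (r ^ 2 * (m * ∑ i, q i ^ 2 * B i z)) := by
      simp only [hD, dotProduct, Finset.mul_sum, ← Finset.sum_sub_distrib,
        ← Finset.sum_add_distrib]
      refine Finset.sum_congr rfl fun i _ => ?_
      simp only [hV]
      ring
    rw [e]
    linarith
  have hDval : ∫ z, D z ∂roundLaw M d =
      ∑ i, (r * l i * q i - r * (q i * l i) * (1 - (1 - q i) ^ M) +
        (r * (β / 2 + η * m) + 1 / 2 * r ^ 2 * m * q i) *
          (q i * ∫ z, B i z ∂roundLaw M d)) := by
    simp only [hD]
    rw [integral_finsetSum _ fun i _ => hTi i]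
    refine Finset.sum_congr rfl fun i _ => ?_
    rw [integral_add (hUi i) ((hBi i).const_mul _),
      integral_sub ((hVi i).const_mul _) ((hAi i).const_mul _), integral_const_mul,
      integral_const_mul, integral_const_mul, hVint,
      integral_mul_resamplingCount ho hS01 c i]
    ring
  have hDle : ∫ z, D z ∂roundLaw M d ≤ κ - 3 / 4 * (r * m) ^ 2 := by
    have hsum : ∑ i, (r * (1 / (Real.exp 1 * M) + β + 2 * η * m) + r ^ 2 * m * q i) ≤
        κ - 3 / 4 * (r * m) ^ 2 := by
      rw [Finset.sum_add_distrib, Finset.sum_const, ← Finset.mul_sum, Finset.card_univ,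
        Fintype.card_fin, nsmul_eq_mul]
      have := mul_le_mul_of_nonneg_left (sum_meanAction_le ho hS01 hSm c)
        (show 0 ≤ r ^ 2 * m by positivity)
      have e : (d : ℝ) * (r * (1 / (Real.exp 1 * M) + β + 2 * η * m)) =
        r * (d / (Real.exp 1 * M) + β * d + 2 * η * m * d) := by ring
      rw [hκ, e]
      nlinarith
    rw [hDval]
    refine (Finset.sum_le_sum fun i _ => ?_).trans hsum
    have h1 := mul_one_sub_pow_le (hq0 i) (hq1 i) hM
    have h2 : q i * ∫ z, B i z ∂roundLaw M d ≤ 2 :=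
      meanAction_mul_integral_resamplingCount_sq_le ho hS01 c i
    have h3 : l i * (q i * (1 - q i) ^ M) ≤ 1 / (Real.exp 1 * M) :=
      (mul_le_of_le_one_left (mul_nonneg (hq0 i) (pow_nonneg (sub_nonneg.2 (hq1 i)) M))
        (hl i).2).trans h1
    have h4 : 0 ≤ r * (β / 2 + η * m) + 1 / 2 * r ^ 2 * m * q i :=
      add_nonneg (by positivity) (mul_nonneg (by positivity) (hq0 i))
    have h5 := mul_le_mul_of_nonneg_left h2 h4
    have h6 := mul_le_mul_of_nonneg_left h3 hr.le
    linarith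
  have hfin : ∫ z, (1 + 3 / 4 * (r * m) ^ 2 + D z) ∂roundLaw M d ≤ Real.exp κ := by
    rw [integral_add (integrable_const _) hDint]
    have := Real.add_one_le_exp κ
    simp only [integral_const, probReal_univ, one_smul]
    linarith
  calc _ ≤ ∫⁻ z, ENNReal.ofReal (Real.exp (-κ) * (1 + 3 / 4 * (r * m) ^ 2 + D z))
        ∂roundLaw M d := by
        refine lintegral_mono fun z => ENNReal.ofReal_le_ofReal ?_
        rw [sub_eq_neg_add, Real.exp_add]
        exact mul_le_mul_of_nonneg_left (hpt z) (Real.exp_pos _).le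
    _ = ENNReal.ofReal (∫ z, Real.exp (-κ) * (1 + 3 / 4 * (r * m) ^ 2 + D z) ∂roundLaw M d) :=
        (ofReal_integral_eq_lintegral_ofReal (hDi.const_mul _) (Filter.Eventually.of_forall
          fun z => mul_nonneg (Real.exp_pos _).le ((Real.exp_pos _).le.trans (hpt z)))).symm
    _ ≤ 1 := by
        rw [ENNReal.ofReal_le_one, integral_const_mul, Real.exp_neg,
          inv_mul_le_iff₀ (Real.exp_pos _), mul_one]
        exact hfin

end

/-! ### Chernoff bounds along the filtration. -/

/-- Integrating out fresh randomness `Z` that is independent of the past `𝒢`. -/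
lemma lintegral_mul_comp_le {Ω E F : Type*} {𝒢 mΩ : MeasurableSpace Ω} [MeasurableSpace E]
    [MeasurableSpace F] {μ : Measure Ω} {ν : Measure F} [IsProbabilityMeasure μ] [SFinite ν]
    (h𝒢 : 𝒢 ≤ mΩ) {Y : Ω → ENNReal} (hY : Measurable[𝒢] Y) {X : Ω → E} (hX : Measurable[𝒢] X)
    {Z : Ω → F} (hZ : Measurable Z) (hlaw : μ.map Z = ν)
    (hind : Indep (MeasurableSpace.comap Z inferInstance) 𝒢 μ) {f : E × F → ENNReal}
    (hf : Measurable f) (hf1 : ∀ ω, ∫⁻ z, f (X ω, z) ∂ν ≤ 1) :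
    ∫⁻ ω, Y ω * f (X ω, Z ω) ∂μ ≤ ∫⁻ ω, Y ω ∂μ := by
  have hYX : Measurable[𝒢] fun ω => (Y ω, X ω) := hY.prodMk hX
  have hYX' : Measurable fun ω => (Y ω, X ω) := hYX.mono h𝒢 le_rfl
  have hindep : IndepFun (fun ω => (Y ω, X ω)) Z μ :=
    (indep_of_indep_of_le_right hind hYX.comap_le).symm
  have hprod := (indepFun_iff_map_prod_eq_prod_map_map hYX'.aemeasurable hZ.aemeasurable).1 hindep
  have hg : Measurable fun p : (ENNReal × E) × F => p.1.1 * f (p.1.2, p.2) := by fun_prop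
  calc ∫⁻ ω, Y ω * f (X ω, Z ω) ∂μ
      = ∫⁻ p, p.1.1 * f (p.1.2, p.2) ∂(μ.map fun ω => ((Y ω, X ω), Z ω)) :=
        (lintegral_map hg (hYX'.prodMk hZ)).symm
    _ = ∫⁻ y, ∫⁻ z, y.1 * f (y.2, z) ∂ν ∂(μ.map fun ω => (Y ω, X ω)) := by
        rw [hprod, hlaw, lintegral_prod _ hg.aemeasurable]
    _ = ∫⁻ ω, ∫⁻ z, Y ω * f (X ω, z) ∂ν ∂μ :=
        lintegral_map hg.lintegral_prod_right' hYX'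
    _ ≤ ∫⁻ ω, Y ω ∂μ := by
        refine lintegral_mono fun ω => ?_
        rw [lintegral_const_mul _ (by fun_prop)]
        exact mul_le_of_le_one_right' (hf1 ω)

section

variable {Ω E F : Type*} {mΩ : MeasurableSpace Ω} [MeasurableSpace E] [MeasurableSpace F]
  {μ : Measure Ω} {ν : Measure F}

/-- Chernoff bound for sums of functions of a predictable process and of fresh randomness. -/
lemma measureReal_sum_ge_le [IsProbabilityMeasure μ] [SFinite ν] (ℱ : Filtration ℕ mΩ) {T : ℕ}
    {X : ℕ → Ω → E} (hX : ∀ t < T, Measurable[ℱ t] (X t)) {Z : ℕ → Ω → F}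
    (hZ : ∀ t < T, Measurable[ℱ (t + 1)] (Z t)) (hlaw : ∀ t < T, μ.map (Z t) = ν)
    (hind : ∀ t < T, Indep (MeasurableSpace.comap (Z t) inferInstance) (ℱ t) μ) {g : E × F → ℝ}
    (hg : Measurable g)
    (hg1 : ∀ t < T, ∀ ω, ∫⁻ z, ENNReal.ofReal (Real.exp (g (X t ω, z))) ∂ν ≤ 1) (a : ℝ) :
    μ.real {ω | a ≤ ∑ t ∈ Finset.range T, g (X t ω, Z t ω)} ≤ Real.exp (-a) := by
  -- A nonnegative supermartingale; working in `ENNReal` avoids integrability conditions.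
  set Y : ℕ → Ω → ENNReal := fun n ω =>
    ∏ t ∈ Finset.range n, ENNReal.ofReal (Real.exp (g (X t ω, Z t ω))) with hY
  have hYm : ∀ n ≤ T, Measurable[ℱ n] (Y n) := by
    intro n hn
    refine Finset.measurable_fun_prod _ fun t ht => ?_
    have htn : t < n := Finset.mem_range.1 ht
    have h1 : Measurable[ℱ n] (X t) := (hX t (by omega)).mono (ℱ.mono htn.le) le_rfl
    have h2 : Measurable[ℱ n] (Z t) := (hZ t (by omega)).mono (ℱ.mono htn) le_rfl
    exact ENNReal.measurable_ofReal.comp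
      (Real.measurable_exp.comp (hg.comp (h1.prodMk h2)))
  have hint : ∀ n ≤ T, ∫⁻ ω, Y n ω ∂μ ≤ 1 := by
    intro n
    induction n with
    | zero => simp [hY]
    | succ n ih =>
      intro hn
      refine le_trans ?_ (ih (by omega))
      have hZm : Measurable (Z n) := (hZ n hn).mono (ℱ.le _) le_rfl
      have h := lintegral_mul_comp_le (ℱ.le n) (hYm n (by omega)) (hX n hn) hZm (hlaw n hn)
        (hind n hn) (f := fun p => ENNReal.ofReal (Real.exp (g p))) (by fun_prop) (hg1 n hn)
      simpa only [hY, Finset.prod_range_succ] using h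
  have hYsum : ∀ ω, Y T ω =
      ENNReal.ofReal (Real.exp (∑ t ∈ Finset.range T, g (X t ω, Z t ω))) := fun ω => by
    rw [Real.exp_sum, ENNReal.ofReal_prod_of_nonneg fun t _ => (Real.exp_pos _).le]
  have hpos : ENNReal.ofReal (Real.exp a) ≠ 0 := by simp [Real.exp_pos]
  have hmark : μ {ω | a ≤ ∑ t ∈ Finset.range T, g (X t ω, Z t ω)} ≤
      ENNReal.ofReal (Real.exp (-a)) := by
    calc μ {ω | a ≤ ∑ t ∈ Finset.range T, g (X t ω, Z t ω)}
        ≤ μ {ω | ENNReal.ofReal (Real.exp a) ≤ Y T ω} := by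
          refine measure_mono fun ω hω => ?_
          simp only [Set.mem_ofPred_eq, hYsum] at hω ⊢
          exact ENNReal.ofReal_le_ofReal (Real.exp_le_exp.2 hω)
      _ ≤ (∫⁻ ω, Y T ω ∂μ) / ENNReal.ofReal (Real.exp a) :=
          meas_ge_le_lintegral_div ((hYm T le_rfl).mono (ℱ.le T) le_rfl).aemeasurable hpos
            ENNReal.ofReal_ne_top
      _ ≤ 1 / ENNReal.ofReal (Real.exp a) := by gcongr; exact hint T le_rfl
      _ = ENNReal.ofReal (Real.exp (-a)) := by
          rw [one_div, Real.exp_neg, ENNReal.ofReal_inv_of_pos (Real.exp_pos a)]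
  exact ENNReal.toReal_le_of_le_ofReal (Real.exp_pos _).le hmark

end

/-! ### Measurability of the algorithm and the high-probability bound. -/

section

variable {d m M : ℕ} {S : Finset (Fin d → ℝ)} {o : (Fin d → ℝ) → (Fin d → ℝ)}

lemma measurable_sampledAction (ho : IsLinearOracle S o) (η : ℝ) (k : Fin (M + 1)) :
    Measurable fun p : ((Fin d → ℝ) × (Fin d → ℝ)) × (Fin (M + 1) → Fin d → ℝ) =>
      sampledAction o η p.1.1 p.2 k := by
  unfold sampledAction
  exact ho.measurable.comp ((measurable_fst.fst.const_smul η).sub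
    ((measurable_pi_apply k).comp measurable_snd))

/-- The loss estimate of one round, as a function of the past estimate, the loss and the fresh
perturbations. -/
def roundEstimate (o : (Fin d → ℝ) → (Fin d → ℝ)) (η β : ℝ)
    (p : ((Fin d → ℝ) × (Fin d → ℝ)) × (Fin (M + 1) → Fin d → ℝ)) : Fin d → ℝ :=
  logEstimate β (sampledAction o η p.1.1 p.2) p.1.2

/-- The excess of the loss of the action played in one round over its discounted estimate. -/
def roundExcess (S : Finset (Fin d → ℝ)) (o : (Fin d → ℝ) → (Fin d → ℝ)) (η β : ℝ)
    (p : ((Fin d → ℝ) × (Fin d → ℝ)) × (Fin (M + 1) → Fin d → ℝ)) : ℝ :=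
  sampledAction o η p.1.1 p.2 0 ⬝ᵥ p.1.2 -
    discountedLoss S o η (η • p.1.1) (roundEstimate o η β p)

lemma measurable_roundEstimate (ho : IsLinearOracle S o)
    (hS01 : ∀ v ∈ S, ∀ i, v i = 0 ∨ v i = 1) (η β : ℝ) :
    Measurable (roundEstimate (M := M) o η β) := by
  refine measurable_pi_lambda _ fun i => ?_
  have hV : ∀ k : Fin (M + 1), Measurable
      fun p : ((Fin d → ℝ) × (Fin d → ℝ)) × (Fin (M + 1) → Fin d → ℝ) =>
        sampledAction o η p.1.1 p.2 k i := fun k =>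
    (measurable_pi_apply i).comp (measurable_sampledAction ho η k)
  have hl : Measurable fun p : ((Fin d → ℝ) × (Fin d → ℝ)) × (Fin (M + 1) → Fin d → ℝ) =>
      p.1.2 i := (measurable_pi_apply i).comp measurable_fst.snd
  have hK : Measurable fun p : ((Fin d → ℝ) × (Fin d → ℝ)) × (Fin (M + 1) → Fin d → ℝ) =>
      (resamplingCount (sampledAction o η p.1.1 p.2) i : ℝ) := by
    simp_rw [fun p : ((Fin d → ℝ) × (Fin d → ℝ)) × (Fin (M + 1) → Fin d → ℝ) =>
      resamplingCount_eq_sum (V := sampledAction o η p.1.1 p.2) (i := i)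
        fun k => hS01 _ (ho.mem _) i]
    refine Finset.measurable_fun_sum _ fun k _ => Finset.measurable_fun_prod _ fun j _ => ?_
    split_ifs
    · exact measurable_const.sub (hV j.succ)
    · exact measurable_const
  exact (((((hK.mul (hV 0)).mul hl).const_mul β).const_add 1).log).const_mul (1 / β)

lemma measurable_actionProb (ho : IsLinearOracle S o) (v : Fin d → ℝ) :
    Measurable fun c => actionProb o c v := by
  have hs : MeasurableSet {p : (Fin d → ℝ) × (Fin d → ℝ) | o (p.1 - p.2) = v} :=
    (ho.measurable.comp (measurable_fst.sub measurable_snd)) (measurableSet_singleton v)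
  exact (measurable_measure_prodMk_left (ν := perturbationLaw d) hs).ennreal_toReal

lemma measurable_discountedLoss (ho : IsLinearOracle S o) (η : ℝ) :
    Measurable fun p : (Fin d → ℝ) × (Fin d → ℝ) => discountedLoss S o η p.1 p.2 := by
  refine Finset.measurable_fun_sum _ fun v _ => ?_
  have hdot : Measurable fun p : (Fin d → ℝ) × (Fin d → ℝ) => v ⬝ᵥ p.2 := by
    unfold dotProduct; fun_prop
  exact ((measurable_actionProb ho v).comp measurable_fst).mul
    (hdot.mul (hdot.const_mul η).neg.exp)

lemma measurable_roundExcess (ho : IsLinearOracle S o)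
    (hS01 : ∀ v ∈ S, ∀ i, v i = 0 ∨ v i = 1) (η β : ℝ) :
    Measurable (roundExcess (M := M) S o η β) := by
  have hp : Measurable fun p : ((Fin d → ℝ) × (Fin d → ℝ)) × (Fin (M + 1) → Fin d → ℝ) =>
      (η • p.1.1, roundEstimate o η β p) :=
    (measurable_fst.fst.const_smul η).prodMk (measurable_roundEstimate ho hS01 η β)
  have h1 := (measurable_discountedLoss (S := S) ho η).comp hp
  have h2 : Measurable fun p : ((Fin d → ℝ) × (Fin d → ℝ)) × (Fin (M + 1) → Fin d → ℝ) =>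
      sampledAction o η p.1.1 p.2 0 ⬝ᵥ p.1.2 := by
    refine Finset.measurable_fun_sum _ fun i _ => ?_
    exact ((measurable_pi_apply i).comp (measurable_sampledAction ho η 0)).mul
      ((measurable_pi_apply i).comp measurable_fst.snd)
  have h3 := h2.sub h1
  exact h3

lemma measurable_cumEstimate (ho : IsLinearOracle S o)
    (hS01 : ∀ v ∈ S, ∀ i, v i = 0 ∨ v i = 1) (η β : ℝ) {Ω : Type*} {mΩ : MeasurableSpace Ω}
    (ℱ : Filtration ℕ mΩ) {T : ℕ} {ℓ : ℕ → Ω → Fin d → ℝ} (hℓ : ∀ t < T, Measurable[ℱ t] (ℓ t))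
    {Z : ℕ → Ω → Fin (M + 1) → Fin d → ℝ} (hZ : ∀ t < T, Measurable[ℱ (t + 1)] (Z t)) {n : ℕ}
    (hn : n ≤ T) :
    Measurable[ℱ n] fun ω => cumEstimate o η β (fun t => ℓ t ω) (fun t => Z t ω) n := by
  induction n with
  | zero => exact measurable_const
  | succ n ih =>
    have h1 := (ih (by omega)).mono (ℱ.mono n.le_succ) le_rfl
    have h2 := (hℓ n hn).mono (ℱ.mono n.le_succ) le_rfl
    have h3 := (measurable_roundEstimate ho hS01 η β).comp ((h1.prodMk h2).prodMk (hZ n hn))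
    have h4 := h1.add h3
    exact h4

/-- With `r = 1/(ms)` the accumulated quadratic term is `7/(8(e-2)) < 1.22`, below `log 4`. It is
absorbed by the gap between `log(5/(4δ))` and `log(5/δ)`, which is why the learner event may take
`4δ/5` of the confidence budget. -/
lemma excess_budget_le {m d M T r η β δ s : ℝ} (hm : 0 < m) (hT : 0 < T) (hδ : 0 < δ)
    (hs : 0 < s) (hs2 : s ^ 2 = 2 * (Real.exp 1 - 2) * T) (hr : r = 1 / (m * s)) :
    (Real.log (5 / (4 * δ)) +
      T * (r * (d / (Real.exp 1 * M) + β * d + 2 * η * m * d) + 7 / 4 * r ^ 2 * m ^ 2)) / r ≤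
      T * (d / (Real.exp 1 * M) + β * d + 2 * η * m * d) + m * s * Real.log (5 / δ) := by
  have hr0 : 0 < r := by rw [hr]; positivity
  have hlog : Real.log (5 / (4 * δ)) = Real.log (5 / δ) - Real.log 4 := by
    rw [← Real.log_div (by positivity) (by norm_num)]
    congr 1
    field_simp
  have hlog4 : (1.386 : ℝ) ≤ Real.log 4 := by
    rw [show (4 : ℝ) = 2 ^ 2 by norm_num, Real.log_pow]
    have := Real.log_two_gt_d9
    push_cast
    linarith
  have he := Real.exp_one_gt_d9
  have hrms : r * (m * s) = 1 := by rw [hr]; field_simp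
  rw [div_le_iff₀ hr0, hlog]
  have hTr : T * (7 / 4 * r ^ 2 * m ^ 2) ≤ Real.log 4 := by
    have h1 : r ^ 2 * m ^ 2 * (2 * (Real.exp 1 - 2) * T) = 1 := by
      rw [← hs2, ← mul_pow, ← mul_pow, mul_assoc, hrms, one_pow]
    have h2 : 0 < r ^ 2 * m ^ 2 * T := by positivity
    nlinarith
  have h3 : m * s * Real.log (5 / δ) * r = Real.log (5 / δ) := by
    rw [show m * s * Real.log (5 / δ) * r = r * (m * s) * Real.log (5 / δ) by ring, hrms, one_mul]
  rw [add_mul, h3]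
  linarith

/-- A high-probability regret bound for FPL+GR.P from which both bounds of the theorem follow. -/
theorem regret_le_with_high_probability
    {T : ℕ} (hm : 1 ≤ m) (hmd : m ≤ d) (hT : 1 ≤ T) (hS : S.Nonempty)
    (hS01 : ∀ v ∈ S, ∀ i, v i = 0 ∨ v i = 1) (hSm : ∀ v ∈ S, ∑ i, |v i| ≤ m)
    (ho : IsLinearOracle S o) {η β : ℝ} (hη : 0 < η) (hβ : 0 < β) (hM : 0 < M) {δ : ℝ}
    (hδ : 0 < δ) (hδ1 : δ < 1) {Ω : Type*} [mΩ : MeasurableSpace Ω] (μ : Measure Ω)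
    [IsProbabilityMeasure μ] (ℱ : Filtration ℕ mΩ)
    (ℓ : ℕ → Ω → Fin d → ℝ) (hℓ : ∀ t < T, Measurable[ℱ t] (ℓ t))
    (hℓ01 : ∀ t < T, ∀ ω i, ℓ t ω i ∈ Set.Icc (0 : ℝ) 1)
    (Z : ℕ → Ω → Fin (M + 1) → Fin d → ℝ) (hZ : ∀ t < T, Measurable[ℱ (t + 1)] (Z t))
    (hZlaw : ∀ t < T, μ.map (Z t) = roundLaw M d)
    (hZindep : ∀ t < T, Indep (MeasurableSpace.comap (Z t) inferInstance) (ℱ t) μ) :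
    1 - δ ≤ μ.real {ω | regret S hS T
      (playedAction o η β (fun t => ℓ t ω) (fun t => Z t ω)) (fun t => ℓ t ω) ≤
        m * (Real.log (d / m) + 1) / η + 2 * η * m * d * T + d * T / (Real.exp 1 * M) + β * d * T +
          m * Real.log (5 * d / δ) / β +
            m * √(2 * (Real.exp 1 - 2) * T) * Real.log (5 / δ)} := by
  have hm0 : (0 : ℝ) < m := by exact_mod_cast hm
  have hd1 : (1 : ℝ) ≤ d := by exact_mod_cast hm.trans hmd
  have hT1 : (1 : ℝ) ≤ T := by exact_mod_cast hT
  have he := Real.exp_one_gt_d9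
  set s := √(2 * (Real.exp 1 - 2) * T) with hs
  have hs2 : s ^ 2 = 2 * (Real.exp 1 - 2) * T := Real.sq_sqrt (by nlinarith)
  have hs1 : 1 ≤ s := Real.one_le_sqrt.2 (by nlinarith)
  have hs0 : 0 < s := one_pos.trans_le hs1
  -- Since `2(e-2)T ≥ 1`, this choice satisfies `rm ≤ 1`, as the quadratic exponential bound
  -- requires.
  set r := 1 / (m * s) with hr
  have hr0 : 0 < r := by positivity
  have hrm : r * m ≤ 1 := by
    have : r * m = 1 / s := by rw [hr]; field_simp
    rw [this, div_le_one hs0]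
    exact hs1
  set κ := r * (d / (Real.exp 1 * M) + β * d + 2 * η * m * d) + 7 / 4 * r ^ 2 * m ^ 2 with hκ
  set L : ℕ → Ω → Fin d → ℝ := fun t ω =>
    cumEstimate o η β (fun t => ℓ t ω) (fun t => Z t ω) t with hL
  set X : ℕ → Ω → (Fin d → ℝ) × (Fin d → ℝ) := fun t ω => (L t ω, ℓ t ω) with hX
  have hXm : ∀ t < T, Measurable[ℱ t] (X t) := fun t ht =>
    (measurable_cumEstimate ho hS01 η β ℱ hℓ hZ ht.le).prodMk (hℓ t ht)
  set lest : ((Fin d → ℝ) × (Fin d → ℝ)) × (Fin (M + 1) → Fin d → ℝ) → Fin d → ℝ :=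
    roundEstimate o η β with hlest
  have hlm : Measurable lest := measurable_roundEstimate ho hS01 η β
  set excess : ((Fin d → ℝ) × (Fin d → ℝ)) × (Fin (M + 1) → Fin d → ℝ) → ℝ :=
    roundExcess S o η β with hexcess
  have hexm : Measurable excess := measurable_roundExcess ho hS01 η β
  set bad : Set Ω := {ω | Real.log (5 / (4 * δ)) ≤
    ∑ t ∈ Finset.range T, (r * excess (X t ω, Z t ω) - κ)} with hbad
  -- Each coordinate event receives `δ/(5d)`, in total `δ/5`, so with `bad` the failure probability
  -- is at most `δ`.
  set badEst : Fin d → Set Ω := fun i => {ω | Real.log (5 * d / δ) ≤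
    ∑ t ∈ Finset.range T, β * (lest (X t ω, Z t ω) i - (X t ω).2 i)} with hbadEst
  have hbad_le : μ.real bad ≤ 4 * δ / 5 := by
    have h := measureReal_sum_ge_le ℱ hXm hZ hZlaw hZindep (g := fun p => r * excess p - κ)
      ((hexm.const_mul r).sub_const κ) (fun t ht ω =>
        lintegral_exp_excess_le ho hS01 hSm hM hη hβ hr0 hrm (η • L t ω) (hℓ01 t ht ω))
      (Real.log (5 / (4 * δ)))
    rw [Real.exp_neg, Real.exp_log (by positivity), inv_div] at h
    exact h
  have hbadEst_le : ∀ i, μ.real (badEst i) ≤ δ / (5 * d) := by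
    intro i
    have h := measureReal_sum_ge_le ℱ hXm hZ hZlaw hZindep
      (g := fun p => β * (lest p i - p.1.2 i))
      ((((measurable_pi_apply i).comp hlm).sub
        ((measurable_pi_apply i).comp measurable_fst.snd)).const_mul β) (fun t ht ω =>
        lintegral_exp_logEstimate_le ho hS01 hβ (η • L t ω) (hℓ01 t ht ω) i)
      (Real.log (5 * d / δ))
    rw [Real.exp_neg, Real.exp_log (by positivity), inv_div] at h
    exact h
  have hcover : Set.univ ⊆ {ω | regret S hS T
      (playedAction o η β (fun t => ℓ t ω) (fun t => Z t ω)) (fun t => ℓ t ω) ≤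
        m * (Real.log (d / m) + 1) / η + 2 * η * m * d * T + d * T / (Real.exp 1 * M) + β * d * T +
          m * Real.log (5 * d / δ) / β + m * s * Real.log (5 / δ)} ∪ (bad ∪ ⋃ i, badEst i) := by
    intro ω _
    by_cases hω : ω ∈ bad ∪ ⋃ i, badEst i
    · exact Or.inr hω
    refine Or.inl ?_
    simp only [Set.mem_union, Set.mem_iUnion, not_or, not_exists, hbad, hbadEst,
      Set.mem_ofPred_eq, not_le] at hω
    obtain ⟨hω1, hω2⟩ := hω
    rw [Set.mem_ofPred_eq]
    unfold regret
    refine Finset.sup'_le hS _ fun u hu => ?_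
    have hLsucc : ∀ t, L (t + 1) ω = L t ω + lest (X t ω, Z t ω) := fun t => rfl
    have hest0 : ∀ t < T, ∀ i, 0 ≤ lest (X t ω, Z t ω) i := fun t ht i =>
      logEstimate_nonneg hβ
        (grEstimate_nonneg (oracle_mem_Icc ho hS01 _ i).1 (hℓ01 t ht ω i).1)
    have hlead := sum_discountedLoss_le ho hS01 hSm hm hmd hη (L := fun t => L t ω)
      (l := fun t => lest (X t ω, Z t ω)) rfl hLsucc hest0 hu
    have hLsum : ∀ n, L n ω = ∑ t ∈ Finset.range n, lest (X t ω, Z t ω) := by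
      intro n
      induction n with
      | zero => rfl
      | succ n ih => rw [hLsucc, ih, Finset.sum_range_succ]
    have hlogd : 0 ≤ Real.log (5 * d / δ) :=
      Real.log_nonneg (by rw [le_div_iff₀ hδ]; linarith)
    have hcomp : u ⬝ᵥ L T ω - ∑ t ∈ Finset.range T, u ⬝ᵥ ℓ t ω ≤
        m * Real.log (5 * d / δ) / β := by
      have e : u ⬝ᵥ L T ω - ∑ t ∈ Finset.range T, u ⬝ᵥ ℓ t ω =
          ∑ i, u i * ∑ t ∈ Finset.range T, (lest (X t ω, Z t ω) i - ℓ t ω i) := by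
        rw [hLsum, dotProduct_sum, ← Finset.sum_sub_distrib]
        simp_rw [← dotProduct_sub, dotProduct, Finset.mul_sum]
        rw [Finset.sum_comm]
        rfl
      rw [e]
      calc _ ≤ ∑ i, |u i| * (Real.log (5 * d / δ) / β) := by
            refine Finset.sum_le_sum fun i _ => ?_
            have h1 := hω2 i
            rw [← Finset.mul_sum] at h1
            have h2 : ∑ t ∈ Finset.range T, (lest (X t ω, Z t ω) i - ℓ t ω i) ≤
                Real.log (5 * d / δ) / β := by
              rw [le_div_iff₀' hβ]; exact h1.le
            rcases hS01 u hu i with h | h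
            · simp [h]
            · simpa [h] using h2
        _ = (∑ i, |u i|) * (Real.log (5 * d / δ) / β) := (Finset.sum_mul ..).symm
        _ ≤ m * (Real.log (5 * d / δ) / β) :=
            mul_le_mul_of_nonneg_right (hSm u hu) (by positivity)
        _ = _ := (mul_div_assoc ..).symm
    have hex : ∑ t ∈ Finset.range T, excess (X t ω, Z t ω) ≤
        T * (d / (Real.exp 1 * M) + β * d + 2 * η * m * d) + m * s * Real.log (5 / δ) := by
      refine le_trans ?_ (excess_budget_le (M := (M : ℝ)) hm0 (by linarith) hδ hs0 hs2 hr)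
      rw [← hκ, le_div_iff₀ hr0]
      rw [Finset.sum_sub_distrib, ← Finset.mul_sum, Finset.sum_const, Finset.card_range,
        nsmul_eq_mul] at hω1
      linarith
    -- Adding and subtracting the discounted losses splits the regret into the excess (`hex`), the
    -- leader bound (`hlead`) and the comparator error (`hcomp`).
    have hsplit : ∑ t ∈ Finset.range T,
        (playedAction o η β (fun t => ℓ t ω) (fun t => Z t ω) t - u) ⬝ᵥ ℓ t ω =
        ∑ t ∈ Finset.range T, excess (X t ω, Z t ω) +
          ∑ t ∈ Finset.range T, discountedLoss S o η (η • L t ω) (lest (X t ω, Z t ω)) -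
            ∑ t ∈ Finset.range T, u ⬝ᵥ ℓ t ω := by
      rw [← Finset.sum_add_distrib, ← Finset.sum_sub_distrib]
      refine Finset.sum_congr rfl fun t _ => ?_
      rw [sub_dotProduct]
      simp only [hexcess, hX, hL, playedAction, roundExcess]
      ring
    rw [hsplit]
    have e2 : T * (d / (Real.exp 1 * M) + β * d + 2 * η * m * d) =
      2 * η * m * d * T + d * T / (Real.exp 1 * M) + β * d * T := by ring
    linarith
  have h1 : (1 : ℝ) ≤ _ := (probReal_univ (μ := μ)).symm.le.trans
    ((measureReal_mono (μ := μ) hcover (by finiteness)).trans (measureReal_union_le _ _))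
  have h2 : μ.real (bad ∪ ⋃ i, badEst i) ≤ δ := by
    refine (measureReal_union_le _ _).trans ?_
    have h3 := (measureReal_iUnion_fintype_le (μ := μ) badEst).trans
      (Finset.sum_le_sum fun i _ => hbadEst_le i)
    rw [Finset.sum_const, Finset.card_univ, Fintype.card_fin, nsmul_eq_mul] at h3
    have h4 : (d : ℝ) * (δ / (5 * d)) = δ / 5 := by field_simp
    linarith
  linarith

end

end

end FPLGRP

/-! ### Deduction of the two stated bounds. -/

theorem theorem2
    -- action set `S ⊆ {0,1}^d` with `‖v‖₁ ≤ m` on `S`, and an optimization oracle for it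
    (d m T : ℕ) (hm : 1 ≤ m) (hmd : m ≤ d) (hT : 1 ≤ T)
    (S : Finset (Fin d → ℝ)) (hS : S.Nonempty)
    (hS01 : ∀ v ∈ S, ∀ i, v i = 0 ∨ v i = 1) (hSm : ∀ v ∈ S, ∑ i, |v i| ≤ m)
    (o : (Fin d → ℝ) → (Fin d → ℝ)) (ho : FPLGRP.IsLinearOracle S o)
    -- parameters of the algorithm and confidence parameter
    (η β : ℝ) (hη : 0 < η) (hβ : 0 < β) (M : ℕ) (hM : 0 < M) (δ : ℝ) (hδ : 0 < δ)
    -- `ℱ t` is the information available to the environment before round `t` (from `0`)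
    {Ω : Type*} [mΩ : MeasurableSpace Ω] (μ : Measure Ω) [IsProbabilityMeasure μ]
    (ℱ : Filtration ℕ mΩ)
    -- non-oblivious losses in `[0,1]^d`: `ℓ t` may depend arbitrarily on what precedes round `t`
    (ℓ : ℕ → Ω → Fin d → ℝ) (hℓ : ∀ t < T, Measurable[ℱ t] (ℓ t))
    (hℓ01 : ∀ t < T, ∀ ω i, ℓ t ω i ∈ Set.Icc (0 : ℝ) 1)
    -- the `M + 1` perturbation vectors of round `t`: fresh, with i.i.d. Exp(1) components
    (Z : ℕ → Ω → Fin (M + 1) → Fin d → ℝ) (hZ : ∀ t < T, Measurable[ℱ (t + 1)] (Z t))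
    (hZlaw : ∀ t < T, μ.map (Z t) =
      Measure.pi fun _ : Fin (M + 1) => Measure.pi fun _ : Fin d => expMeasure 1)
    (hZindep : ∀ t < T, Indep (MeasurableSpace.comap (Z t) inferInstance) (ℱ t) μ)
    -- the regret of FPL+GR.P
    (R : Ω → ℝ)
    (hR : ∀ ω, R ω = FPLGRP.regret S hS T
      (FPLGRP.playedAction o η β (fun t => ℓ t ω) (fun t => Z t ω)) (fun t => ℓ t ω)) :
    1 - δ ≤ μ.real {ω | R ω ≤
        m * (Real.log (d / m) + 1) / η
        + η * (M * m * √(2 * T * Real.log (5 / δ)) + 2 * m * d * √(T * Real.log (5 / δ))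
            + 2 * m * d * T)
        + d * T / (Real.exp 1 * M)
        + β * (M * √(2 * m * T * Real.log (5 / δ)) + 2 * d * √(T * Real.log (5 / δ))
            + 2 * d * T)
        + m * Real.log (5 * d / δ) / β
        + m * √(2 * (Real.exp 1 - 2) * T) * Real.log (5 / δ)
        + √(8 * T * Real.log (5 / δ))
        + √(2 * (Real.exp 1 - 2) * T)}
    ∧ (M = ⌈√((d : ℝ) * T / m)⌉₊ → β = √((m : ℝ) / (d * T)) →
        η = √((Real.log (d / m) + 1) / (d * T)) →
      1 - δ ≤ μ.real {ω | R ω ≤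
        3 * m * √(d * T * (Real.log (d / m) + 1))
        + √(m * d * T) * (Real.log (5 * d / δ) + 2)
        + √(2 * m * T * Real.log (5 / δ)) * (√(Real.log (d / m) + 1) + 1)
        + 1.2 * m * √T * Real.log (5 / δ)
        + √T * (√(8 * Real.log (5 / δ)) + 1.2)
        + 2 * √(d * Real.log (5 / δ)) * (m * √(Real.log (d / m) + 1) + √m)}) := by
  obtain rfl : R = fun ω => FPLGRP.regret S hS T
      (FPLGRP.playedAction o η β (fun t => ℓ t ω) (fun t => Z t ω)) (fun t => ℓ t ω) := funext hR
  rcases le_or_gt 1 δ with hδ1 | hδ1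
  · exact ⟨(sub_nonpos.2 hδ1).trans measureReal_nonneg,
      fun _ _ _ => (sub_nonpos.2 hδ1).trans measureReal_nonneg⟩
  have key := FPLGRP.regret_le_with_high_probability hm hmd hT hS hS01 hSm ho hη hβ hM hδ hδ1 μ ℱ
    ℓ hℓ hℓ01 Z hZ hZlaw hZindep
  have hm1 : (1 : ℝ) ≤ m := by exact_mod_cast hm
  have hm0 : (0 : ℝ) < m := one_pos.trans_le hm1
  have hmd' : (m : ℝ) ≤ d := by exact_mod_cast hmd
  have hd0 : (0 : ℝ) < d := hm0.trans_le hmd'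
  have hT0 : (0 : ℝ) < T := by exact_mod_cast hT
  have hM0 : (0 : ℝ) < M := by exact_mod_cast hM
  have hlog : 0 ≤ Real.log (5 / δ) := Real.log_nonneg (by rw [le_div_iff₀ hδ]; linarith)
  have mono : ∀ {f : Ω → ℝ} {a b : ℝ}, a ≤ b → μ.real {ω | f ω ≤ a} ≤ μ.real {ω | f ω ≤ b} :=
    fun hab => measureReal_mono fun ω hω => by
      rw [Set.mem_ofPred_eq] at hω ⊢
      exact hω.trans hab
  refine ⟨key.trans (mono ?_), fun hMeq hβeq hηeq => key.trans (mono ?_)⟩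
  -- The stated bound exceeds the proved one by nonnegative terms only, including one surplus `β d
  -- T`.
  · have h1 : 0 ≤ η * (M * m * √(2 * T * Real.log (5 / δ)) +
        2 * m * d * √(T * Real.log (5 / δ))) := by positivity
    have h2 : 0 ≤ β * (M * √(2 * m * T * Real.log (5 / δ)) +
        2 * d * √(T * Real.log (5 / δ)) + d * T) := by positivity
    have h3 : 0 ≤ √(8 * T * Real.log (5 / δ)) + √(2 * (Real.exp 1 - 2) * T) := by positivity
    linarith
  -- In terms of `x = √A`, `y = √(dT)`, `w = √m`, the tuning is `η = x/y`, `β = w/y`, `M ≥ y/w`. The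
  -- two `η` terms give `3m·xy`; truncation and logarithmic biases give at most `2wy`.
  · have hA1 : 1 ≤ Real.log (d / m) + 1 := by
      linarith [Real.log_nonneg ((one_le_div hm0).2 hmd')]
    set A := Real.log (d / m) + 1
    set K := Real.log (5 / δ)
    set x := √A with hx
    set y := √((d : ℝ) * T) with hy
    set w := √(m : ℝ) with hw
    have hA0 : 0 < A := one_pos.trans_le hA1
    have hx0 : 0 < x := Real.sqrt_pos.2 hA0
    have hy0 : 0 < y := Real.sqrt_pos.2 (by positivity)
    have hw0 : 0 < w := Real.sqrt_pos.2 hm0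
    have hx2 : x ^ 2 = A := Real.sq_sqrt hA0.le
    have hy2 : y ^ 2 = d * T := Real.sq_sqrt (by positivity)
    have hw2 : w ^ 2 = m := Real.sq_sqrt hm0.le
    have hη' : η = x / y := by rw [hηeq, Real.sqrt_div hA0.le]
    have hβ' : β = w / y := by rw [hβeq, Real.sqrt_div hm0.le]
    have hM' : y / w ≤ M := by
      rw [hMeq, hy, hw, ← Real.sqrt_div (by positivity)]
      exact Nat.le_ceil _
    have e1 : m * A / η = m * (y * x) := by rw [hη', ← hx2]; field_simp
    have e2 : 2 * η * m * d * T = 2 * (m * (y * x)) := by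
      rw [show 2 * η * m * d * T = 2 * η * m * (d * T) by ring, hη', ← hy2]; field_simp
    have e3 : d * T / (Real.exp 1 * M) ≤ w * y := by
      rw [div_le_iff₀ (by positivity), ← hy2]
      have h1 : 1 ≤ Real.exp 1 := by linarith [Real.exp_one_gt_d9]
      have h2 : y ≤ w * M := by rwa [div_le_iff₀' hw0] at hM'
      calc y ^ 2 = y * y * 1 := by ring
        _ ≤ y * (w * M) * Real.exp 1 := by gcongr
        _ = _ := by ring
    have e4 : β * d * T = w * y := by
      rw [mul_assoc, hβ', ← hy2]; field_simp
    have e5 : m * Real.log (5 * d / δ) / β = w * y * Real.log (5 * d / δ) := by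
      rw [hβ', ← hw2]; field_simp
    -- Numerically, `2(e-2) < 1.44 = 1.2²`.
    have e6 : √(2 * (Real.exp 1 - 2) * T) ≤ 1.2 * √T := by
      rw [Real.sqrt_mul' _ hT0.le]
      refine mul_le_mul_of_nonneg_right ?_ (Real.sqrt_nonneg _)
      rw [Real.sqrt_le_left (by norm_num)]
      have := Real.exp_one_lt_d9
      norm_num
      linarith
    have e7 : m * √(2 * (Real.exp 1 - 2) * T) * K ≤ 1.2 * m * √T * K := by
      refine mul_le_mul_of_nonneg_right ?_ hlog
      calc m * √(2 * (Real.exp 1 - 2) * T) ≤ m * (1.2 * √T) := by gcongr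
        _ = _ := by ring
    have f1 : √(d * T * A) = y * x := Real.sqrt_mul (by positivity) _
    have f2 : √(m * d * T) = w * y := by rw [mul_assoc]; exact Real.sqrt_mul hm0.le _
    have g1 : 0 ≤ √(2 * m * T * K) * (x + 1) := by positivity
    have g2 : 0 ≤ √T * (√(8 * K) + 1.2) := by positivity
    have g3 : 0 ≤ 2 * √(d * K) * (m * x + w) := by positivity
    rw [f1, f2, e1, e2, e4, e5]
    linarith
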